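/- Let $L_1,L_2$ be smooth manifolds of dimensions $k_1,k_2\ge 0$ and let $f_j:L_j\to\mathbb S^{2n_j+1}\subset\mathbb C^{n_j+1}$ ($j=1,2$) be minimal immersions (of class $C^2$) with induced metrics $g_j$, which are $C$-totally real: $\mathrm{Re}\langle i f_j(x),\,d(f_j)_x v\rangle=0$ for all $x\in L_j$, $v\in T_xL_j$. Let $T\subset\mathbb R$ be an open interval and let $\gamma=(\gamma_1,\gamma_2)=(a e^{is_1},\,b e^{is_2}):T\to\mathbb S^3\subset\mathbb C\oplus\mathbb C$ be an immersed curve, where $a=\cos s$, $b=\sin s$ and $s:T\to(0,\tfrac{\pi}{2})$, $s_1,s_2:T\to\mathbb R$ are $C^2$. Assume that for some $C_1\in\mathbb R$ one of the following holds. (1) (Varying magnitudes.) The zeros of $ds/dt$ are isolated in $T$, and wherever $ds/dt\ne0$ one has, with $\dot{\ }=\frac{d}{ds}$ and $\Theta=(a\dot s_1)^2+(b\dot s_2)^2$, that $\Theta>0$ and $$b^2\dot s_2=C_1a^2\dot s_1,\qquad -k_1\frac ba+k_2\frac ab-\frac{ab\,(\dot s_1^2-\dot s_2^2)}{(a\dot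 s_1)^2+(b\dot s_2)^2}=-\frac{\dot\Theta}{2\Theta(1+\Theta)} .$$ (2) (Steady magnitudes.) $s\equiv\sigma$ is constant, where $\sigma$ is a minimum point on $(0,\tfrac\pi2)$ of $$\sigma\mapsto\frac{1+(C_1^2-1)\cos^2\sigma}{(\cos\sigma)^{2k_1+2}(\sin\sigma)^{2k_2+2}},$$ and $b^2\,\frac{ds_2}{dt}=C_1a^2\,\frac{ds_1}{dt}$ on $T$. Let $G_\gamma(t,x,y)=(\gamma_1(t)f_1(x),\,\gamma_2(t)f_2(y))$ on $T\times L_1\times L_2$ (the spiral minimal product of $f_1$ and $f_2$ along $\gamma$), and let $g_\gamma$ be the metric induced by $G_\gamma$ from $\mathbb C^{n_1+1}\oplus\mathbb C^{n_2+1}$. Then $$g_\gamma=|\gamma'(t)|^2dt^2\oplus a^2g_1\oplus b^2g_2,\qquad \Delta_{g_\gamma}G_\gamma=-(k_1+k_2+1)\,G_\gamma ,$$ where $\Delta_{g_\gamma}$ is the Laplace–Beltrami operator (so $|\gamma'|\,dt$ is the arc length element $dt_{arc}$ of $\gamma$), and $G_\gamma$ is a minimal immersion (of class $C^2$) into the unit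 sphere $\mathbb S^{2n_1+2n_2+3}$. -/

import Mathlib

open scoped Manifold ContDiff Topology

noncomputable section

/-! ### Riemannian geometry in charts

All manifolds are modelled on a finite-dimensional real space `E`; coordinates on `E` are the
coordinates in a basis `b` of `E`. -/

section Geometry

variable {E : Type*} [NormedAddCommGroup E] [NormedSpace ℝ E]
  {H : Type*} [TopologicalSpace H] (I : ModelWithCorners ℝ E H)
  {M : Type*} [TopologicalSpace M] [ChartedSpace H M]
  {ι : Type*} [Fintype ι] [DecidableEq ι] (b : Module.Basis ι ℝ E)
  {V : Type*} [NormedAddCommGroup V] [InnerProductSpace ℝ V]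

/-- The metric induced on `M` by a map `f : M → V` into a Euclidean space:
`g_p (v, w) = ⟨df_p v, df_p w⟩`. -/
def inducedMetric (f : M → V) (p : M) (v w : TangentSpace I p) : ℝ :=
  (inner ℝ : V → V → ℝ) (mfderiv I 𝓘(ℝ, V) f p v) (mfderiv I 𝓘(ℝ, V) f p w)

/-- The coefficients `g_{ij}` at the coordinate point `u` of a metric `g` on `M`, in the
preferred chart at `p`. -/
def metricCoeff (g : (q : M) → TangentSpace I q → TangentSpace I q → ℝ) (p : M) (u : E) :
    Matrix ι ι ℝ :=
  Matrix.of fun i j =>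
    g ((extChartAt I p).symm u)
      (mfderiv 𝓘(ℝ, E) I (extChartAt I p).symm u (b i))
      (mfderiv 𝓘(ℝ, E) I (extChartAt I p).symm u (b j))

/-- The coordinate expression of a map `f : M → V` in the preferred chart at `p`. -/
def inChart (f : M → V) (p : M) (u : E) : V := f ((extChartAt I p).symm u)

/-- The Laplace-Beltrami operator of the metric `g`, applied to a vector valued map `f`:
`Δ_g f = (1 / √det g) ∑ i, ∂_i (∑ j, √det g g^{ij} ∂_j f)`,
evaluated at `p` in the preferred chart at `p`. -/
def laplaceBeltrami (g : (q : M) → TangentSpace I q → TangentSpace I q → ℝ)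
    (f : M → V) (p : M) : V :=
  (1 / √(metricCoeff I b g p (extChartAt I p p)).det) •
    ∑ i, fderiv ℝ
      (fun u : E => ∑ j, (√(metricCoeff I b g p u).det * (metricCoeff I b g p u)⁻¹ i j) •
        fderiv ℝ (inChart I f p) u (b j))
      (extChartAt I p p) (b i)

/-- For `f : M → V` with values in the unit sphere: the span of the radial direction `f p` and of
the tangent directions `df_p (T_p M)`. Its orthogonal complement is the normal space at `p` of the
immersion `f` into the sphere. -/
def radialTangentSpan (f : M → V) (p : M) : Submodule ℝ V :=
  Submodule.span ℝ ({f p} ∪ Set.range fun v : TangentSpace I p => (mfderiv I 𝓘(ℝ, V) f p v : V))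

variable [FiniteDimensional ℝ V]

/-- The second fundamental form at `p` of an immersion `f` of `M` into the unit sphere of `V`:
the component of the second derivative of `f` (computed in the preferred chart at `p`) that is
normal to `M` in the sphere. -/
def secondFundamentalForm (f : M → V) (p : M) (v w : E) : V :=
  (radialTangentSpan I f p)ᗮ.starProjection
    (fderiv ℝ (fun u : E => fderiv ℝ (inChart I f p) u w) (extChartAt I p p) v)

/-- The (unnormalized) mean curvature vector at `p` of an immersion `f` of `M` into the unit
sphere of `V`: the trace of the second fundamental form with respect to the induced metric. -/
def meanCurvature (f : M → V) (p : M) : V :=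
  ∑ i, ∑ j, (metricCoeff I b (inducedMetric I f) p (extChartAt I p p))⁻¹ i j •
    secondFundamentalForm I f p (b i) (b j)

/-- On the open set `U`, the map `f` is a minimal immersion (of class `C²`) into the unit sphere
of `V`. -/
structure IsMinimalImmersionOn (f : M → V) (U : Set M) : Prop where
  contMDiffOn : ContMDiffOn I 𝓘(ℝ, V) 2 f U
  mem_sphere : ∀ p ∈ U, f p ∈ Metric.sphere (0 : V) 1
  immersion : ∀ p ∈ U, Function.Injective (mfderiv I 𝓘(ℝ, V) f p)
  minimal : ∀ p ∈ U, meanCurvature I b f p = 0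

end Geometry

/-- The standard coordinates of `ℝᵏ`. -/
def stdBasis (k : ℕ) : Module.Basis (Fin k) ℝ (EuclideanSpace ℝ (Fin k)) :=
  (EuclideanSpace.basisFun (Fin k) ℝ).toBasis

/-- The standard coordinates of `ℝ × ℝᵏ × ℝˡ`. -/
def prodBasis (k l : ℕ) : Module.Basis (Unit ⊕ (Fin k ⊕ Fin l)) ℝ
    (ℝ × (EuclideanSpace ℝ (Fin k) × EuclideanSpace ℝ (Fin l))) :=
  (Module.Basis.singleton Unit ℝ).prod ((stdBasis k).prod (stdBasis l))

/-- A map `f : L → ℂᵐ` is `C`-totally real if `J f(x) = i f(x)` is orthogonal to the tangent space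
`df_x (T_x L)` for every `x`. -/
def IsCTotallyReal {k m : ℕ} {L : Type*} [TopologicalSpace L]
    [ChartedSpace (EuclideanSpace ℝ (Fin k)) L] (f : L → EuclideanSpace ℂ (Fin m)) : Prop :=
  ∀ (x : L) (v : TangentSpace (𝓡 k) x),
    inner ℝ (Complex.I • f x) (mfderiv (𝓡 k) 𝓘(ℝ, EuclideanSpace ℂ (Fin m)) f x v) = 0

/-! ### The curves `γ` -/

/-- The derivative `dh/ds` of `h` with respect to the parameter `s`, where both are given as
functions of `t` (and `ds/dt ≠ 0`). -/
def derivWrt (s h : ℝ → ℝ) (t : ℝ) : ℝ := deriv h t / deriv s t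

/-- `Θ = (a ds₁/ds)² + (b ds₂/ds)²` with `a = cos s`, `b = sin s`. -/
def spiralTheta (s s₁ s₂ : ℝ → ℝ) (t : ℝ) : ℝ :=
  (Real.cos (s t) * derivWrt s s₁ t) ^ 2 + (Real.sin (s t) * derivWrt s s₂ t) ^ 2

/-- The ODE system for `s₁`, `s₂` as functions of the parameter `s`, at a point `t` with
`ds/dt ≠ 0`. -/
structure SolvesSpiralODEAt (k₁ k₂ : ℕ) (C₁ : ℝ) (s s₁ s₂ : ℝ → ℝ) (t : ℝ) : Prop where
  theta_pos : 0 < spiralTheta s s₁ s₂ t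
  first : Real.sin (s t) ^ 2 * derivWrt s s₂ t = C₁ * (Real.cos (s t) ^ 2 * derivWrt s s₁ t)
  second :
    -(k₁ : ℝ) * (Real.sin (s t) / Real.cos (s t)) + (k₂ : ℝ) * (Real.cos (s t) / Real.sin (s t))
        - Real.cos (s t) * Real.sin (s t) * (derivWrt s s₁ t ^ 2 - derivWrt s s₂ t ^ 2) /
          spiralTheta s s₁ s₂ t
      = -(derivWrt s (spiralTheta s s₁ s₂) t /
          (2 * spiralTheta s s₁ s₂ t * (1 + spiralTheta s s₁ s₂ t)))

/-- Varying magnitudes: `s` is a regular parameter except at isolated joints of `T`, and away from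
the joints the ODE system holds. -/
def IsVaryingSolution (k₁ k₂ : ℕ) (C₁ : ℝ) (T : Set ℝ) (s s₁ s₂ : ℝ → ℝ) : Prop :=
  (∀ t ∈ T, ∀ᶠ u in 𝓝[≠] t, deriv s u ≠ 0) ∧
    ∀ t ∈ T, deriv s t ≠ 0 → SolvesSpiralODEAt k₁ k₂ C₁ s s₁ s₂ t

/-- The function of `σ ∈ (0, π/2)` whose minimum is the limit value of the second parameter
`C₂`, at which the magnitudes become steady. -/
def steadyFunction (k₁ k₂ : ℕ) (C₁ σ : ℝ) : ℝ :=
  (1 + (C₁ ^ 2 - 1) * Real.cos σ ^ 2) /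
    (Real.cos σ ^ (2 * k₁ + 2) * Real.sin σ ^ (2 * k₂ + 2))

/-- Steady magnitudes: `s` is constant, equal to a minimum point of `steadyFunction`, and
`b² s₂' = C₁ a² s₁'` (derivatives in the parameter of the curve). -/
def IsSteadySolution (k₁ k₂ : ℕ) (C₁ : ℝ) (T : Set ℝ) (s s₁ s₂ : ℝ → ℝ) : Prop :=
  (∃ σ ∈ Set.Ioo 0 (Real.pi / 2),
      IsMinOn (steadyFunction k₁ k₂ C₁) (Set.Ioo 0 (Real.pi / 2)) σ ∧ ∀ t ∈ T, s t = σ) ∧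
    ∀ t ∈ T, Real.sin (s t) ^ 2 * deriv s₂ t = C₁ * (Real.cos (s t) ^ 2 * deriv s₁ t)

/-- `γ = (γ₁, γ₂) = (cos s · exp (i s₁), sin s · exp (i s₂))`, an immersed `C²` curve in the unit
sphere of `ℂ ⊕ ℂ` defined on the open interval `T`, is a solution curve for the spiral minimal
product of dimensions `k₁`, `k₂`, of varying or of steady magnitudes. -/
def IsSpiralCurve (k₁ k₂ : ℕ) (T : Set ℝ) (γ₁ γ₂ : ℝ → ℂ) : Prop :=
  IsOpen T ∧ T.OrdConnected ∧
    ∃ (C₁ : ℝ) (s s₁ s₂ : ℝ → ℝ),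
      ContDiffOn ℝ 2 s T ∧ ContDiffOn ℝ 2 s₁ T ∧ ContDiffOn ℝ 2 s₂ T ∧
      (∀ t ∈ T, s t ∈ Set.Ioo 0 (Real.pi / 2)) ∧
      (∀ t ∈ T, γ₁ t = (Real.cos (s t) : ℂ) * Complex.exp (Complex.I * (s₁ t : ℂ))) ∧
      (∀ t ∈ T, γ₂ t = (Real.sin (s t) : ℂ) * Complex.exp (Complex.I * (s₂ t : ℂ))) ∧
      (∀ t ∈ T, deriv γ₁ t ≠ 0 ∨ deriv γ₂ t ≠ 0) ∧
      (IsVaryingSolution k₁ k₂ C₁ T s s₁ s₂ ∨ IsSteadySolution k₁ k₂ C₁ T s s₁ s₂)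

/-! ### The product -/

/-- `G_γ (t, x, y) = (γ₁(t) f₁(x), γ₂(t) f₂(y))`. -/
def spiralProduct {m₁ m₂ : ℕ} {L₁ L₂ : Type*} (γ₁ γ₂ : ℝ → ℂ)
    (f₁ : L₁ → EuclideanSpace ℂ (Fin m₁)) (f₂ : L₂ → EuclideanSpace ℂ (Fin m₂))
    (p : ℝ × (L₁ × L₂)) :
    WithLp 2 (EuclideanSpace ℂ (Fin m₁) × EuclideanSpace ℂ (Fin m₂)) :=
  WithLp.toLp 2 (γ₁ p.1 • f₁ p.2.1, γ₂ p.1 • f₂ p.2.2)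

section Product

variable {k₁ k₂ : ℕ}
  {L₁ : Type*} [TopologicalSpace L₁] [ChartedSpace (EuclideanSpace ℝ (Fin k₁)) L₁]
  {L₂ : Type*} [TopologicalSpace L₂] [ChartedSpace (EuclideanSpace ℝ (Fin k₂)) L₂]

/-- The warped product metric `|γ'(t)|² dt² ⊕ a(t)² g₁ ⊕ b(t)² g₂` on `ℝ × L₁ × L₂`, where
`a = |γ₁|` and `b = |γ₂|`; note that `|γ'(t)| dt` is the arc length element of `γ`. -/
def warpedMetric (γ₁ γ₂ : ℝ → ℂ)
    (g₁ : (x : L₁) → TangentSpace (𝓡 k₁) x → TangentSpace (𝓡 k₁) x → ℝ)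
    (g₂ : (y : L₂) → TangentSpace (𝓡 k₂) y → TangentSpace (𝓡 k₂) y → ℝ)
    (p : ℝ × (L₁ × L₂)) (v w : TangentSpace (𝓘(ℝ, ℝ).prod ((𝓡 k₁).prod (𝓡 k₂))) p) : ℝ :=
  let v' : ℝ × (EuclideanSpace ℝ (Fin k₁) × EuclideanSpace ℝ (Fin k₂)) := v
  let w' : ℝ × (EuclideanSpace ℝ (Fin k₁) × EuclideanSpace ℝ (Fin k₂)) := w
  (‖deriv γ₁ p.1‖ ^ 2 + ‖deriv γ₂ p.1‖ ^ 2) * (v'.1 * w'.1)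
    + ‖γ₁ p.1‖ ^ 2 * g₁ p.2.1 v'.2.1 w'.2.1
    + ‖γ₂ p.1‖ ^ 2 * g₂ p.2.2 v'.2.2 w'.2.2

end Product

end

/-! Beltrami's formula for an immersion `F` into the unit sphere says `ΔF = H - (dim) F`, so the
Laplace equation follows once the mean curvature vanishes. `H` is the projection of the trace `S =
g^{ij} ∂_i ∂_j F` onto the orthogonal complement of the span of `F` and its tangent space.
Minimality therefore means that `S` is a radial plus a tangent vector.

Since `f_j` is a `C`-totally real map into a sphere, `f_j` and `i f_j` are both orthogonal to its
tangent space. Hence `γ_j' f_j` and `γ_j df_j` are orthogonal, the induced metric is the warped one,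
and its inverse is block diagonal. With `ρ = |γ'|²`, the trace for `G_γ` has components `ρ⁻¹ γ_j''
f_j + |γ_j|⁻² γ_j S_j`, where minimality of `f_j` gives `S_j = df_j(w_j) - k_j f_j`. The `w_j` terms
are tangent to `G_γ`, so it suffices that the curvature vector `(ρ⁻¹ γ_j'' - k_j |γ_j|⁻² γ_j)_j` be
`l γ + μ γ'` with real `l, μ` (`meanCurvature_spiralProduct`).

In polar coordinates this is a statement about the three components transverse to `γ`: they must be
proportional to those of the velocity, which is the vanishing of three 2×2 minors
(`SpiralProportional`). For varying magnitudes the ODE system gives the minors where `ds/dt ≠ 0`,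
and continuity carries them over the isolated joints. For steady magnitudes they come from the
critical point equation of the minimized function. -/

/-! ### Determinants of Gram matrices and Beltrami's formula in coordinates -/

section Euclidean

variable {E : Type*} [NormedAddCommGroup E] [NormedSpace ℝ E]
  {ι : Type*} [Fintype ι] [DecidableEq ι]
  {V : Type*} [NormedAddCommGroup V] [InnerProductSpace ℝ V]

/-- Jacobi's formula for the derivative of a determinant. -/
theorem hasFDerivAt_matrix_det {A : E → Matrix ι ι ℝ} {A' : ι → ι → E →L[ℝ] ℝ} {x : E}
    (h : ∀ i j, HasFDerivAt (fun u => A u i j) (A' i j) x) :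
    HasFDerivAt (fun u => (A u).det) (∑ i, ∑ j, (A x).adjugate j i • A' i j) x := by
  -- As a multilinear map of the rows, the determinant has as derivative the sum of determinants
  -- with one row replaced; Cramer's rule turns these into adjugate entries.
  let D : ContinuousMultilinearMap ℝ (fun _ : ι => ι → ℝ) ℝ :=
    ⟨(Matrix.detRowAlternating (n := ι) (R := ℝ)).toMultilinearMap, by
      change Continuous fun M : Matrix ι ι ℝ => M.det
      exact continuous_id.matrix_det⟩
  have hA : HasFDerivAt (fun u => (A u : ι → ι → ℝ))
      (ContinuousLinearMap.pi fun i => ContinuousLinearMap.pi fun j => A' i j) x := by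
    refine hasFDerivAt_pi.2 fun i => hasFDerivAt_pi.2 fun j => h i j
  have := (D.hasFDerivAt (A x : ι → ι → ℝ)).comp x hA
  refine this.congr_fderiv ?_
  ext v
  refine (D.linearDeriv_apply _ _).trans ?_
  simp only [sum_apply, smul_apply]
  refine Finset.sum_congr rfl fun i _ => ?_
  change ((A x).updateRow i (fun j => A' i j v)).det = _
  rw [← Matrix.cramer_transpose_apply, Matrix.cramer_eq_adjugate_mulVec,
    ← Matrix.adjugate_transpose]
  simp [Matrix.mulVec, dotProduct]

theorem DifferentiableAt.matrix_det {A : E → Matrix ι ι ℝ} {x : E}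
    (h : ∀ i j, DifferentiableAt ℝ (fun u => A u i j) x) :
    DifferentiableAt ℝ (fun u => (A u).det) x :=
  (hasFDerivAt_matrix_det fun i j => (h i j).hasFDerivAt).differentiableAt

theorem DifferentiableAt.matrix_inv {A : E → Matrix ι ι ℝ} {x : E}
    (h : ∀ i j, DifferentiableAt ℝ (fun u => A u i j) x) (hx : (A x).det ≠ 0) (i j : ι) :
    DifferentiableAt ℝ (fun u => (A u)⁻¹ i j) x := by
  -- Cramer's rule; valid also where the determinant vanishes, since both inverses are then zero by
  -- convention.
  have : (fun u => (A u)⁻¹ i j) =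
      fun u => (A u).det⁻¹ * ((A u).updateRow j (Pi.single i 1)).det := by
    ext u
    rw [Matrix.inv_def, Ring.inverse_eq_inv', Matrix.smul_apply, Matrix.adjugate_apply,
      smul_eq_mul]
  rw [this]
  refine ((DifferentiableAt.matrix_det h).inv hx).mul (DifferentiableAt.matrix_det fun k l => ?_)
  by_cases hk : k = j
  · subst hk; simp
  · simpa [Matrix.updateRow_ne hk] using h k l

/-- `∂_v √(det A) = ½ √(det A) tr (A⁻¹ ∂_v A)`. -/
theorem fderiv_sqrt_det {A : E → Matrix ι ι ℝ} {x : E}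
    (h : ∀ i j, DifferentiableAt ℝ (fun u => A u i j) x) (hx : 0 < (A x).det) (v : E) :
    fderiv ℝ (fun u => √(A u).det) x v =
      √(A x).det * (2⁻¹ * ∑ i, ∑ j, (A x)⁻¹ j i * fderiv ℝ (fun u => A u i j) x v) := by
  rw [((hasFDerivAt_matrix_det fun i j => (h i j).hasFDerivAt).sqrt hx.ne').fderiv]
  have hadj : ∀ i j, (A x).adjugate j i = (A x).det * (A x)⁻¹ j i := fun i j => by
    rw [Matrix.inv_def, Ring.inverse_eq_inv', Matrix.smul_apply, smul_eq_mul,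
      mul_inv_cancel_left₀ hx.ne']
  simp only [smul_apply, sum_apply, smul_eq_mul, hadj,
    mul_assoc, ← Finset.mul_sum]
  have hs : √(A x).det ≠ 0 := (Real.sqrt_pos.2 hx).ne'
  have hd := Real.mul_self_sqrt hx.le
  set r := √(A x).det
  rw [← hd]
  field_simp

/-- The divergence `∑ ∂_i (√det g g^{ij} ∂_j F)` of a gradient is orthogonal to all the `∂_k F`. -/
theorem inner_partial_divergence_eq_zero {e : ι → E} {w : ι → E → V} {x : E}
    (hw : ∀ i, DifferentiableAt ℝ (w i) x)
    (hsymm : ∀ i j, fderiv ℝ (w i) x (e j) = fderiv ℝ (w j) x (e i))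
    (hli : LinearIndependent ℝ fun i => w i x) (k : ι) :
    inner ℝ (w k x) (∑ i, fderiv ℝ (fun u => ∑ j, (√(Matrix.gram ℝ fun i => w i u).det *
      (Matrix.gram ℝ fun i => w i u)⁻¹ i j) • w j u) x (e i)) = 0 := by
  set G : E → Matrix ι ι ℝ := fun u => Matrix.gram ℝ fun i => w i u with hG
  have hGd : ∀ i j, DifferentiableAt ℝ (fun u => G u i j) x :=
    fun i j => (hw i).inner ℝ (hw j)
  have hdet : 0 < (G x).det := (Matrix.posDef_gram_of_linearIndependent hli).det_pos
  have hev : ∀ᶠ u in 𝓝 x, 0 < (G u).det :=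
    (DifferentiableAt.matrix_det hGd).continuousAt.eventually (lt_mem_nhds hdet)
  have hc : ∀ i j, DifferentiableAt ℝ (fun u => √(G u).det * (G u)⁻¹ i j) x := fun i j =>
    ((DifferentiableAt.matrix_det hGd).sqrt hdet.ne').mul
      (DifferentiableAt.matrix_inv hGd hdet.ne' i j)
  set X : ι → E → V := fun i u => ∑ j, (√(G u).det * (G u)⁻¹ i j) • w j u with hX
  have hXd : ∀ i, DifferentiableAt ℝ (X i) x := fun i =>
    DifferentiableAt.fun_sum fun j _ => (hc i j).smul (hw j)
  -- Contracting `g^{ij}` with `g_{jk}` leaves `√det g` times a Kronecker delta. The product rule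
  -- can then move `∂_i` from `X i` onto `w k`.
  have hinner : ∀ i, (fun u => inner ℝ (w k u) (X i u)) =ᶠ[𝓝 x]
      fun u => if i = k then √(G u).det else 0 := fun i => by
    filter_upwards [hev] with u hu
    have h1 : (G u)⁻¹ * G u = 1 := Matrix.nonsing_inv_mul _ hu.ne'.isUnit
    have h2 := congrFun (congrFun h1 i) k
    rw [Matrix.mul_apply, Matrix.one_apply] at h2
    calc inner ℝ (w k u) (X i u) = √(G u).det * ∑ j, (G u)⁻¹ i j * G u j k := by
          simp only [hX, inner_sum, inner_smul_right, Finset.mul_sum, mul_assoc]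
          refine Finset.sum_congr rfl fun j _ => ?_
          change _ = √(G u).det * ((G u)⁻¹ i j * inner ℝ (w j u) (w k u))
          rw [real_inner_comm]
      _ = _ := by rw [h2]; split_ifs <;> simp
  have hprod : ∀ i, inner ℝ (w k x) (fderiv ℝ (X i) x (e i)) =
      (if i = k then fderiv ℝ (fun u => √(G u).det) x (e k) else 0)
        - inner ℝ (fderiv ℝ (w k) x (e i)) (X i x) := fun i => by
    have h1 := fderiv_inner_apply ℝ (hw k) (hXd i) (e i)
    rw [(hinner i).fderiv_eq] at h1
    rw [eq_sub_iff_add_eq, ← h1]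
    split_ifs with hik
    · rw [hik]
    · simp
  have hGsymm : ∀ i j, (G x)⁻¹ i j = (G x)⁻¹ j i := fun i j => by
    have : (G x).transpose = G x := by
      ext i j; exact real_inner_comm _ _
    conv_lhs => rw [← this, ← Matrix.transpose_nonsing_inv, Matrix.transpose_apply]
  rw [inner_sum, Finset.sum_congr rfl fun i _ => hprod i, Finset.sum_sub_distrib]
  simp only [Finset.sum_ite_eq', Finset.mem_univ, if_true]
  rw [fderiv_sqrt_det hGd hdet, sub_eq_zero]
  -- The symmetry `∂_k w_i = ∂_i w_k` expresses `∂_k g_{ij}` through derivatives of `w k` alone. Its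
  -- two terms have equal traces against `g⁻¹`, which absorbs the factor ½ in `fderiv_sqrt_det`.
  have hdG : ∀ i j, fderiv ℝ (fun u => G u i j) x (e k) =
      inner ℝ (w i x) (fderiv ℝ (w k) x (e j)) + inner ℝ (fderiv ℝ (w k) x (e i)) (w j x) :=
    fun i j => by
      have := fderiv_inner_apply ℝ (hw i) (hw j) (e k)
      rw [hsymm i k, hsymm j k] at this
      exact this
  simp only [hdG, hX, inner_sum, inner_smul_right, mul_add, Finset.sum_add_distrib, mul_assoc,
    ← Finset.mul_sum]
  rw [← mul_add]
  congr 1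
  have e1 : ∑ i, ∑ j, (G x)⁻¹ j i * inner ℝ (w i x) (fderiv ℝ (w k) x (e j)) =
      ∑ i, ∑ j, (G x)⁻¹ i j * inner ℝ (fderiv ℝ (w k) x (e i)) (w j x) := by
    rw [Finset.sum_comm]
    simp only [real_inner_comm]
  have e2 : ∑ i, ∑ j, (G x)⁻¹ j i * inner ℝ (fderiv ℝ (w k) x (e i)) (w j x) =
      ∑ i, ∑ j, (G x)⁻¹ i j * inner ℝ (fderiv ℝ (w k) x (e i)) (w j x) := by
    refine Finset.sum_congr rfl fun i _ => Finset.sum_congr rfl fun j _ => ?_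
    rw [hGsymm]
  rw [e1, e2]; ring

/-- A unit vector field is orthogonal to its derivatives. -/
theorem inner_fderiv_eq_zero_of_norm_eq_one {F : E → V} {x : E} (hF : DifferentiableAt ℝ F x)
    (h1 : ∀ᶠ u in 𝓝 x, ‖F u‖ = 1) (v : E) : inner ℝ (F x) (fderiv ℝ F x v) = 0 := by
  have h := fderiv_inner_apply ℝ hF hF v
  have h0 : (fun u => inner ℝ (F u) (F u)) =ᶠ[𝓝 x] fun _ => (1 : ℝ) := by
    filter_upwards [h1] with u hu
    rw [real_inner_self_eq_norm_sq, hu, one_pow]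
  rw [h0.fderiv_eq, real_inner_comm (F x)] at h
  simp at h
  linarith

/-- The normal component of the second derivative of a unit vector field in the direction of the
field. -/
theorem inner_fderiv_fderiv_of_norm_eq_one {F : E → V} {x : E} (hF : ContDiffAt ℝ 2 F x)
    (h1 : ∀ᶠ u in 𝓝 x, ‖F u‖ = 1) (v w : E) :
    inner ℝ (F x) (fderiv ℝ (fun u => fderiv ℝ F u w) x v) =
      -inner ℝ (fderiv ℝ F x v) (fderiv ℝ F x w) := by
  have hF' : DifferentiableAt ℝ (fun u => fderiv ℝ F u w) x :=
    ((hF.fderiv_right (m := 1) le_rfl).differentiableAt one_ne_zero).clm_apply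
      (differentiableAt_const w)
  have h := fderiv_inner_apply ℝ (hF.differentiableAt two_ne_zero) hF' v
  have h0 : (fun u => inner ℝ (F u) (fderiv ℝ F u w)) =ᶠ[𝓝 x] fun _ => (0 : ℝ) := by
    filter_upwards [h1.eventually_nhds, hF.eventually (by simp)] with u hu hFu
    exact inner_fderiv_eq_zero_of_norm_eq_one (hFu.differentiableAt two_ne_zero) hu w
  rw [h0.fderiv_eq] at h
  simp at h
  linarith

theorem fderiv_fderiv_apply_comm {F : E → V} {x : E} (hF : ContDiffAt ℝ 2 F x) (v w : E) :
    fderiv ℝ (fun u => fderiv ℝ F u w) x v = fderiv ℝ (fun u => fderiv ℝ F u v) x w := by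
  have hd : DifferentiableAt ℝ (fderiv ℝ F) x :=
    (hF.fderiv_right (m := 1) le_rfl).differentiableAt one_ne_zero
  have h : ∀ v w, fderiv ℝ (fun u => fderiv ℝ F u w) x v = fderiv ℝ (fderiv ℝ F) x v w :=
    fun v w => by
      rw [fderiv_clm_apply hd (differentiableAt_const w)]
      simp
  rw [h, h]
  exact (hF.isSymmSndFDerivAt (by simp)).eq v w

variable (b : Module.Basis ι ℝ E)

/-- The trace of the second derivative of a unit vector field with respect to the induced metric,
in the direction of the field. -/
theorem inner_trace_fderiv_fderiv {F : E → V} {x : E} (hF : ContDiffAt ℝ 2 F x)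
    (h1 : ∀ᶠ u in 𝓝 x, ‖F u‖ = 1) (hli : LinearIndependent ℝ fun i => fderiv ℝ F x (b i)) :
    inner ℝ (F x) (∑ i, ∑ j, (Matrix.gram ℝ fun i => fderiv ℝ F x (b i))⁻¹ i j •
      fderiv ℝ (fun u => fderiv ℝ F u (b j)) x (b i)) = -(Fintype.card ι : ℝ) := by
  set G : Matrix ι ι ℝ := Matrix.gram ℝ fun i => fderiv ℝ F x (b i) with hG
  have hdet : 0 < G.det := (Matrix.posDef_gram_of_linearIndependent hli).det_pos
  have hmul : G⁻¹ * G = 1 := Matrix.nonsing_inv_mul _ hdet.ne'.isUnit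
  simp only [inner_sum, inner_smul_right, inner_fderiv_fderiv_of_norm_eq_one hF h1]
  have : ∀ i, ∑ j, G⁻¹ i j * -inner ℝ (fderiv ℝ F x (b i)) (fderiv ℝ F x (b j)) = -1 := fun i => by
    have h2 := congrFun (congrFun hmul i) i
    rw [Matrix.mul_apply, Matrix.one_apply_eq] at h2
    rw [← h2, ← Finset.sum_neg_distrib]
    refine Finset.sum_congr rfl fun j _ => ?_
    rw [hG, Matrix.gram_apply, real_inner_comm, mul_neg]
  rw [Finset.sum_congr rfl fun i _ => this i]
  simp

/-- Beltrami's formula for an immersion of a coordinate domain into the unit sphere: the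
Laplacian of the position vector is the mean curvature vector in the sphere minus the dimension
times the position vector. -/
theorem divergence_gradient_eq_trace_sub [FiniteDimensional ℝ V] {F : E → V} {x : E}
    (hF : ContDiffAt ℝ 2 F x)
    (h1 : ∀ᶠ u in 𝓝 x, ‖F u‖ = 1) (hli : LinearIndependent ℝ fun i => fderiv ℝ F x (b i)) :
    (1 / √(Matrix.gram ℝ fun i => fderiv ℝ F x (b i)).det) •
      ∑ i, fderiv ℝ (fun u => ∑ j, (√(Matrix.gram ℝ fun i => fderiv ℝ F u (b i)).det *
        (Matrix.gram ℝ fun i => fderiv ℝ F u (b i))⁻¹ i j) • fderiv ℝ F u (b j)) x (b i) =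
    (Submodule.span ℝ ({F x} ∪ Set.range fun v => fderiv ℝ F x v))ᗮ.starProjection
      (∑ i, ∑ j, (Matrix.gram ℝ fun i => fderiv ℝ F x (b i))⁻¹ i j •
        fderiv ℝ (fun u => fderiv ℝ F u (b j)) x (b i)) - (Fintype.card ι : ℝ) • F x := by
  have hw : ∀ i, DifferentiableAt ℝ (fun u => fderiv ℝ F u (b i)) x := fun i =>
    ((hF.fderiv_right (m := 1) le_rfl).differentiableAt one_ne_zero).clm_apply
      (differentiableAt_const _)
  set G : E → Matrix ι ι ℝ := fun u => Matrix.gram ℝ fun i => fderiv ℝ F u (b i) with hG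
  set K := Submodule.span ℝ ({F x} ∪ Set.range fun v => fderiv ℝ F x v) with hK
  have hGd : ∀ i j, DifferentiableAt ℝ (fun u => G u i j) x :=
    fun i j => (hw i).inner ℝ (hw j)
  have hdet : 0 < (G x).det := (Matrix.posDef_gram_of_linearIndependent hli).det_pos
  have hc : ∀ i j, DifferentiableAt ℝ (fun u => √(G u).det * (G u)⁻¹ i j) x := fun i j =>
    ((DifferentiableAt.matrix_det hGd).sqrt hdet.ne').mul
      (DifferentiableAt.matrix_inv hGd hdet.ne' i j)
  set S := ∑ i, ∑ j, (G x)⁻¹ i j • fderiv ℝ (fun u => fderiv ℝ F u (b j)) x (b i) with hS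
  set D := ∑ i, fderiv ℝ (fun u => ∑ j, (√(G u).det * (G u)⁻¹ i j) • fderiv ℝ F u (b j)) x (b i)
    with hD
  have hmemT : ∀ v, fderiv ℝ F x v ∈ K := fun v =>
    Submodule.subset_span (Or.inr ⟨v, rfl⟩)
  have hmemF : F x ∈ K := Submodule.subset_span (Or.inl rfl)
  -- Derivatives falling on the coefficients `√det g · g^{ij}` produce only combinations of the `∂_j
  -- F`, that is, a tangent vector.
  have hDS : ∃ v, D = √(G x).det • S + fderiv ℝ F x v := by
    refine ⟨∑ i, ∑ j, fderiv ℝ (fun u => √(G u).det * (G u)⁻¹ i j) x (b i) • b j, ?_⟩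
    simp only [map_sum, map_smul, hD, hS, Finset.smul_sum, smul_smul, ← Finset.sum_add_distrib]
    refine Finset.sum_congr rfl fun i _ => ?_
    have hcw : ∀ j, DifferentiableAt ℝ
        (fun u => (√(G u).det * (G u)⁻¹ i j) • fderiv ℝ F u (b j)) x :=
      fun j => (hc i j).smul (hw j)
    rw [fderiv_fun_sum fun j _ => hcw j, sum_apply]
    refine Finset.sum_congr rfl fun j _ => ?_
    rw [fderiv_fun_smul (hc i j) (hw j)]
    simp
  obtain ⟨v, hv⟩ := hDS
  have hs : √(G x).det ≠ 0 := (Real.sqrt_pos.2 hdet).ne'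
  have hL : (1 / √(G x).det) • D = S + fderiv ℝ F x ((1 / √(G x).det) • v) := by
    rw [hv, smul_add, smul_smul, one_div_mul_cancel hs, one_smul, map_smul]
  -- The divergence has no tangential part, and its pairing with `F` is minus the dimension because
  -- only `S` contributes; adding the multiple of `F` cancels this.
  have horth : (1 / √(G x).det) • D + (Fintype.card ι : ℝ) • F x ∈ Kᗮ := by
    have hzero := inner_fderiv_eq_zero_of_norm_eq_one (hF.differentiableAt two_ne_zero) h1
    have hTorth : ∀ v, inner ℝ (fderiv ℝ F x v) D = 0 := fun v => by
      have : ∀ k, inner ℝ (fderiv ℝ F x (b k)) D = 0 := fun k =>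
        inner_partial_divergence_eq_zero (e := b) hw
          (fun i j => fderiv_fderiv_apply_comm hF _ _) hli k
      rw [← b.sum_repr v, map_sum, sum_inner]
      refine Finset.sum_eq_zero fun k _ => ?_
      rw [map_smul, inner_smul_left, this, mul_zero]
    rw [hK, Submodule.mem_orthogonal]
    suffices h : ∀ u ∈ ({F x} ∪ Set.range fun v => fderiv ℝ F x v : Set V),
        inner ℝ u ((1 / √(G x).det) • D + (Fintype.card ι : ℝ) • F x) = 0 by
      intro u hu
      induction hu using Submodule.span_induction with
      | mem u hu => exact h u hu
      | zero => exact inner_zero_left _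
      | add u v _ _ hu hv => rw [inner_add_left, hu, hv, add_zero]
      | smul c u _ hu => rw [inner_smul_left, hu, mul_zero]
    rintro u (rfl | ⟨v, rfl⟩)
    · rw [hL, inner_add_right, inner_add_right, hzero, inner_trace_fderiv_fderiv b hF h1 hli,
        inner_smul_right, real_inner_self_eq_norm_sq, h1.self_of_nhds]
      simp
    · rw [inner_add_right, inner_smul_right, inner_smul_right, hTorth, real_inner_comm, hzero]
      simp
  have hP : ∀ u ∈ K, Kᗮ.starProjection u = 0 := fun u hu => by
    rw [Submodule.starProjection_apply_eq_zero_iff, Submodule.orthogonal_orthogonal]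
    exact hu
  -- A vector of `Kᗮ` is its own projection, and the projection kills the tangent and radial terms,
  -- leaving that of `S`.
  rw [eq_sub_iff_add_eq, ← Submodule.starProjection_eq_self_iff.2 horth, hL]
  simp only [map_add, hP _ (hmemT _), map_smul, hP _ hmemF, smul_zero, add_zero]

end Euclidean

/-! ### Transfer to manifolds: mean curvature and Laplacian in the preferred chart -/

section Charts

variable {E : Type*} [NormedAddCommGroup E] [NormedSpace ℝ E]
  {H : Type*} [TopologicalSpace H] (I : ModelWithCorners ℝ E H)
  {M : Type*} [TopologicalSpace M] [ChartedSpace H M]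
  {ι : Type*} (b : Module.Basis ι ℝ E)

theorem inChart_extChartAt {V : Type*} (f : M → V) (p : M) :
    inChart I f p (extChartAt I p p) = f p := by
  simp [inChart]

variable [I.Boundaryless] {V : Type*} [NormedAddCommGroup V] [InnerProductSpace ℝ V]

theorem contMDiffAt_extChartAt_symm {n : ℕ∞ω} [IsManifold I n M] {p : M} {u : E}
    (hu : u ∈ (extChartAt I p).target) : ContMDiffAt 𝓘(ℝ, E) I n (extChartAt I p).symm u :=
  (contMDiffOn_extChartAt_symm p).contMDiffAt (extChartAt_target_mem_nhds' hu)

theorem contDiffAt_inChart {n : ℕ∞ω} [IsManifold I n M] {f : M → V} {p : M} {u : E}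
    (hu : u ∈ (extChartAt I p).target)
    (hf : ContMDiffAt I 𝓘(ℝ, V) n f ((extChartAt I p).symm u)) :
    ContDiffAt ℝ n (inChart I f p) u :=
  (hf.comp u (contMDiffAt_extChartAt_symm I hu)).contDiffAt

theorem fderiv_inChart [IsManifold I 1 M] {f : M → V} {p : M} {u : E}
    (hu : u ∈ (extChartAt I p).target)
    (hf : MDifferentiableAt I 𝓘(ℝ, V) f ((extChartAt I p).symm u)) (v : E) :
    fderiv ℝ (inChart I f p) u v = mfderiv I 𝓘(ℝ, V) f ((extChartAt I p).symm u)
      (mfderiv 𝓘(ℝ, E) I (extChartAt I p).symm u v) := by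
  have h := mfderiv_comp u hf
    ((contMDiffAt_extChartAt_symm I (n := 1) hu).mdifferentiableAt one_ne_zero)
  rw [← mfderiv_eq_fderiv]
  exact congrArg (fun L => L v) h

/-- By the chain rule. This identification lets the coordinate results on Gram matrices apply to
induced metrics. -/
theorem metricCoeff_inducedMetric [IsManifold I 1 M] {f : M → V} {p : M} {u : E}
    (hu : u ∈ (extChartAt I p).target)
    (hf : MDifferentiableAt I 𝓘(ℝ, V) f ((extChartAt I p).symm u)) :
    metricCoeff I b (inducedMetric I f) p u =
      Matrix.gram ℝ fun i => fderiv ℝ (inChart I f p) u (b i) := by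
  ext i j
  simp only [fderiv_inChart I hu hf]
  rfl

theorem bijective_mfderiv_extChartAt_symm [IsManifold I 1 M] {p : M} {u : E}
    (hu : u ∈ (extChartAt I p).target) :
    Function.Bijective (mfderiv 𝓘(ℝ, E) I (extChartAt I p).symm u) := by
  have h := isInvertible_mfderivWithin_extChartAt_symm (I := I) hu
  rw [ModelWithCorners.Boundaryless.range_eq_univ, mfderivWithin_univ] at h
  exact h.bijective

theorem fderiv_inChart_self [IsManifold I 1 M] {f : M → V} {p : M}
    (hf : MDifferentiableAt I 𝓘(ℝ, V) f p) (v : E) :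
    fderiv ℝ (inChart I f p) (extChartAt I p p) v = mfderiv I 𝓘(ℝ, V) f p
      (mfderiv 𝓘(ℝ, E) I (extChartAt I p).symm (extChartAt I p p) v : E) := by
  have := fderiv_inChart I (f := f) (mem_extChartAt_target (I := I) p)
    (by rwa [extChartAt_to_inv]) v
  rw [this]
  congr 2
  all_goals simp

theorem range_mfderiv_eq [IsManifold I 1 M] {f : M → V} {p : M}
    (hf : MDifferentiableAt I 𝓘(ℝ, V) f p) :
    (Set.range fun v : TangentSpace I p => (mfderiv I 𝓘(ℝ, V) f p v : V)) =
      Set.range fun v => fderiv ℝ (inChart I f p) (extChartAt I p p) v := by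
  simp only [fderiv_inChart_self I hf]
  exact ((bijective_mfderiv_extChartAt_symm I
    (mem_extChartAt_target (I := I) p)).surjective.range_comp
      (fun v : E => (mfderiv I 𝓘(ℝ, V) f p v : V))).symm

theorem radialTangentSpan_eq_inChart [IsManifold I 1 M] {f : M → V} {p : M}
    (hf : MDifferentiableAt I 𝓘(ℝ, V) f p) :
    radialTangentSpan I f p = Submodule.span ℝ ({inChart I f p (extChartAt I p p)} ∪
      Set.range fun v => fderiv ℝ (inChart I f p) (extChartAt I p p) v) := by
  rw [inChart_extChartAt]
  exact congrArg (fun S => Submodule.span ℝ ({f p} ∪ S)) (range_mfderiv_eq I hf)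

theorem linearIndependent_fderiv_inChart [IsManifold I 1 M] {f : M → V} {p : M}
    (hf : MDifferentiableAt I 𝓘(ℝ, V) f p)
    (hinj : Function.Injective (mfderiv I 𝓘(ℝ, V) f p)) :
    LinearIndependent ℝ fun i => fderiv ℝ (inChart I f p) (extChartAt I p p) (b i) := by
  refine b.linearIndependent.map' (fderiv ℝ (inChart I f p) (extChartAt I p p)).toLinearMap
    (LinearMap.ker_eq_bot.2 ?_)
  intro v w hvw
  change fderiv ℝ (inChart I f p) (extChartAt I p p) v =
    fderiv ℝ (inChart I f p) (extChartAt I p p) w at hvw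
  rw [fderiv_inChart_self I hf, fderiv_inChart_self I hf] at hvw
  exact (bijective_mfderiv_extChartAt_symm I (mem_extChartAt_target (I := I) p)).injective
    (hinj hvw)

variable [Fintype ι] [DecidableEq ι] [FiniteDimensional ℝ V]

/-- The projection is linear and comes out of the trace. Minimality at `p` thus becomes membership
of the untruncated trace in `radialTangentSpan`. -/
theorem meanCurvature_eq_starProjection [IsManifold I 1 M] {f : M → V} {p : M}
    (hf : MDifferentiableAt I 𝓘(ℝ, V) f p) :
    meanCurvature I b f p = (radialTangentSpan I f p)ᗮ.starProjection
      (∑ i, ∑ j,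
        (Matrix.gram ℝ fun i => fderiv ℝ (inChart I f p) (extChartAt I p p) (b i))⁻¹ i j •
        fderiv ℝ (fun u => fderiv ℝ (inChart I f p) u (b j)) (extChartAt I p p) (b i)) := by
  rw [meanCurvature, metricCoeff_inducedMetric I b (mem_extChartAt_target p)
    (by rwa [extChartAt_to_inv])]
  simp only [map_sum, map_smul]
  rfl

/-- Beltrami's formula for immersions into the unit sphere: `Δ f = H - (dim M) f`. -/
theorem laplaceBeltrami_inducedMetric [IsManifold I 2 M] {f : M → V} {p : M}
    (hf : ContMDiffAt I 𝓘(ℝ, V) 2 f p) (h1 : ∀ᶠ q in 𝓝 p, ‖f q‖ = 1)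
    (hinj : Function.Injective (mfderiv I 𝓘(ℝ, V) f p)) :
    laplaceBeltrami I b (inducedMetric I f) f p =
      meanCurvature I b f p - (Fintype.card ι : ℝ) • f p := by
  have hd := hf.mdifferentiableAt two_ne_zero
  have hsymm : Filter.Tendsto (extChartAt I p).symm (𝓝 (extChartAt I p p)) (𝓝 p) := by
    have := continuousAt_extChartAt_symm (I := I) p
    rwa [ContinuousAt, extChartAt_to_inv] at this
  -- An identity at the centre alone would not do: the outer derivative of the Laplacian
  -- differentiates the metric coefficients.
  have hev : ∀ᶠ u in 𝓝 (extChartAt I p p), metricCoeff I b (inducedMetric I f) p u =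
      Matrix.gram ℝ fun i => fderiv ℝ (inChart I f p) u (b i) := by
    filter_upwards [extChartAt_target_mem_nhds (I := I) p,
      hsymm.eventually ((contMDiffAt_iff_contMDiffAt_nhds (by simp)).1 hf)] with u hu hfu
    exact metricCoeff_inducedMetric I b hu (hfu.mdifferentiableAt two_ne_zero)
  have key := divergence_gradient_eq_trace_sub b (F := inChart I f p)
    (contDiffAt_inChart I (mem_extChartAt_target p) (by rwa [extChartAt_to_inv]))
    (hsymm.eventually h1) (linearIndependent_fderiv_inChart I b hd hinj)
  rw [← radialTangentSpan_eq_inChart I hd, ← meanCurvature_eq_starProjection I b hd,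
    inChart_extChartAt] at key
  rw [← key, laplaceBeltrami, hev.self_of_nhds]
  congr 1
  refine Finset.sum_congr rfl fun i _ => ?_
  congr 1
  refine Filter.EventuallyEq.fderiv_eq ?_
  filter_upwards [hev] with u hu
  rw [hu]

/-- Takahashi's formula. -/
theorem IsMinimalImmersionOn.laplaceBeltrami_eq [IsManifold I 2 M] {f : M → V} {U : Set M}
    (hf : IsMinimalImmersionOn I b f U) (hU : IsOpen U) {p : M} (hp : p ∈ U) :
    laplaceBeltrami I b (inducedMetric I f) f p = -(Fintype.card ι : ℝ) • f p := by
  rw [laplaceBeltrami_inducedMetric I b (hf.contMDiffOn.contMDiffAt (hU.mem_nhds hp)) _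
    (hf.immersion p hp), hf.minimal p hp, zero_sub, neg_smul]
  filter_upwards [hU.mem_nhds hp] with q hq
  simpa using hf.mem_sphere q hq

/-- In coordinates, the trace of the second derivative of a minimal immersion into the unit sphere
is a tangent vector minus the dimension times the position vector. -/
theorem IsMinimalImmersionOn.exists_trace_eq [IsManifold I 2 M] {f : M → V} {U : Set M}
    (hf : IsMinimalImmersionOn I b f U) (hU : IsOpen U) {p : M} (hp : p ∈ U) :
    ∃ w : E, ∑ i, ∑ j,
        (Matrix.gram ℝ fun i => fderiv ℝ (inChart I f p) (extChartAt I p p) (b i))⁻¹ i j •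
        fderiv ℝ (fun u => fderiv ℝ (inChart I f p) u (b j)) (extChartAt I p p) (b i) =
      fderiv ℝ (inChart I f p) (extChartAt I p p) w - (Fintype.card ι : ℝ) • f p := by
  have hfp := hf.contMDiffOn.contMDiffAt (hU.mem_nhds hp)
  have hd := hfp.mdifferentiableAt two_ne_zero
  have hF : ContDiffAt ℝ 2 (inChart I f p) (extChartAt I p p) :=
    contDiffAt_inChart I (mem_extChartAt_target p) (by rwa [extChartAt_to_inv])
  have hsymm : Filter.Tendsto (extChartAt I p).symm (𝓝 (extChartAt I p p)) (𝓝 p) := by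
    have := continuousAt_extChartAt_symm (I := I) p
    rwa [ContinuousAt, extChartAt_to_inv] at this
  have h1 : ∀ᶠ u in 𝓝 (extChartAt I p p), ‖inChart I f p u‖ = 1 := by
    filter_upwards [hsymm.eventually (hU.mem_nhds hp)] with u hu
    simpa [inChart] using hf.mem_sphere _ hu
  have hmin := hf.minimal p hp
  rw [meanCurvature_eq_starProjection I b hd, Submodule.starProjection_apply_eq_zero_iff,
    Submodule.orthogonal_orthogonal, radialTangentSpan_eq_inChart I hd, Submodule.span_union,
    Submodule.mem_sup] at hmin
  obtain ⟨y, hy, z, hz, hyz⟩ := hmin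
  obtain ⟨c, rfl⟩ := Submodule.mem_span_singleton.1 hy
  have hz' : z ∈ LinearMap.range (fderiv ℝ (inChart I f p) (extChartAt I p p)).toLinearMap :=
    Submodule.span_le.2 (by rintro _ ⟨v, rfl⟩; exact ⟨v, rfl⟩) hz
  obtain ⟨w, rfl⟩ := hz'
  have htr := inner_trace_fderiv_fderiv b hF h1
    (linearIndependent_fderiv_inChart I b hd (hf.immersion p hp))
  -- Pairing with the unit vector `F` removes the tangent part and isolates the radial coefficient.
  have hc : c = -(Fintype.card ι : ℝ) := by
    rw [← htr, ← hyz, inner_add_right, inner_smul_right, real_inner_self_eq_norm_sq,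
      h1.self_of_nhds]
    change _ = _ + inner ℝ _ (fderiv ℝ (inChart I f p) (extChartAt I p p) w)
    rw [inner_fderiv_eq_zero_of_norm_eq_one (hF.differentiableAt two_ne_zero) h1]
    simp
  refine ⟨w, ?_⟩
  rw [← hyz, hc, inChart_extChartAt, neg_smul]
  change _ + fderiv ℝ (inChart I f p) (extChartAt I p p) w = _
  abel

end Charts

/-! ### Planar curves in polar form and the algebra of the curvature equation -/

section Curves

theorem ContDiffOn.hasDerivAt_of_two {f : ℝ → ℝ} {T : Set ℝ} (hf : ContDiffOn ℝ 2 f T)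
    (hT : IsOpen T) {t : ℝ} (ht : t ∈ T) : HasDerivAt f (deriv f t) t :=
  ((hf.contDiffAt (hT.mem_nhds ht)).differentiableAt two_ne_zero).hasDerivAt

theorem ContDiffOn.hasDerivAt_deriv_of_two {f : ℝ → ℝ} {T : Set ℝ} (hf : ContDiffOn ℝ 2 f T)
    (hT : IsOpen T) {t : ℝ} (ht : t ∈ T) : HasDerivAt (deriv f) (deriv (deriv f) t) t :=
  (((hf.deriv_of_isOpen hT (m := 1) le_rfl).contDiffAt (hT.mem_nhds ht)).differentiableAt
    one_ne_zero).hasDerivAt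

theorem ContDiffOn.continuousOn_deriv_deriv_of_two {f : ℝ → ℝ} {T : Set ℝ}
    (hf : ContDiffOn ℝ 2 f T) (hT : IsOpen T) : ContinuousOn (deriv (deriv f)) T :=
  ((hf.deriv_of_isOpen hT (m := 1) le_rfl).deriv_of_isOpen hT (m := 0) le_rfl).continuousOn

/-- The amplitude is complex valued so that the rule applies a second time, to the first derivative
of a polar curve. -/
theorem hasDerivAt_mul_exp_I {r : ℝ → ℂ} {r' : ℂ} {θ : ℝ → ℝ} {θ' t : ℝ}
    (hr : HasDerivAt r r' t) (hθ : HasDerivAt θ θ' t) :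
    HasDerivAt (fun u => r u * Complex.exp (Complex.I * (θ u : ℂ)))
      ((r' + Complex.I * (r t * θ')) * Complex.exp (Complex.I * (θ t : ℂ))) t := by
  refine (hr.mul ((hθ.ofReal_comp.const_mul Complex.I).cexp)).congr_deriv ?_
  ring

/-- The first derivative of a planar curve in polar coordinates. -/
theorem deriv_polar {T : Set ℝ} (hT : IsOpen T) {r θ : ℝ → ℝ} {γ : ℝ → ℂ}
    (hr : ContDiffOn ℝ 2 r T) (hθ : ContDiffOn ℝ 2 θ T)
    (hγ : ∀ t ∈ T, γ t = (r t : ℂ) * Complex.exp (Complex.I * (θ t : ℂ))) {t : ℝ} (ht : t ∈ T) :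
    deriv γ t = (((deriv r t : ℝ) : ℂ) + Complex.I * ((r t : ℂ) * ((deriv θ t : ℝ) : ℂ))) *
      Complex.exp (Complex.I * (θ t : ℂ)) := by
  have h := hasDerivAt_mul_exp_I (hr.hasDerivAt_of_two hT ht).ofReal_comp
    (hθ.hasDerivAt_of_two hT ht)
  refine (h.congr_of_eventuallyEq ?_).deriv
  filter_upwards [hT.mem_nhds ht] with u hu using hγ u hu

/-- The second derivative of a planar curve in polar coordinates. -/
theorem deriv_deriv_polar {T : Set ℝ} (hT : IsOpen T) {r θ : ℝ → ℝ} {γ : ℝ → ℂ}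
    (hr : ContDiffOn ℝ 2 r T) (hθ : ContDiffOn ℝ 2 θ T)
    (hγ : ∀ t ∈ T, γ t = (r t : ℂ) * Complex.exp (Complex.I * (θ t : ℂ))) {t : ℝ} (ht : t ∈ T) :
    deriv (deriv γ) t = (((deriv (deriv r) t - r t * deriv θ t ^ 2 : ℝ) : ℂ) +
      Complex.I * ((2 * deriv r t * deriv θ t + r t * deriv (deriv θ) t : ℝ) : ℂ)) *
      Complex.exp (Complex.I * (θ t : ℂ)) := by
  have h1 : HasDerivAt (fun u => ((deriv r u : ℝ) : ℂ) +
      Complex.I * ((r u : ℂ) * ((deriv θ u : ℝ) : ℂ))) _ t :=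
    (hr.hasDerivAt_deriv_of_two hT ht).ofReal_comp.add
    (((hr.hasDerivAt_of_two hT ht).ofReal_comp.mul
      (hθ.hasDerivAt_deriv_of_two hT ht).ofReal_comp).const_mul Complex.I)
  have h := hasDerivAt_mul_exp_I h1 (hθ.hasDerivAt_of_two hT ht)
  have h2 : deriv γ =ᶠ[𝓝 t] fun u => (((deriv r u : ℝ) : ℂ) +
      Complex.I * ((r u : ℂ) * ((deriv θ u : ℝ) : ℂ))) * Complex.exp (Complex.I * (θ u : ℂ)) := by
    filter_upwards [hT.mem_nhds ht] with u hu using deriv_polar hT hr hθ hγ hu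
  rw [h2.deriv_eq]
  refine (h.deriv).trans ?_
  congr 1
  push_cast
  linear_combination ((r t : ℂ) * ((deriv θ t : ℝ) : ℂ) ^ 2) * Complex.I_sq

theorem norm_mul_exp_I_sq (x y θ : ℝ) :
    ‖((x : ℂ) + Complex.I * (y : ℂ)) * Complex.exp (Complex.I * (θ : ℂ))‖ ^ 2 = x ^ 2 + y ^ 2 := by
  rw [norm_mul, mul_comm Complex.I (θ : ℂ), Complex.norm_exp_ofReal_mul_I, mul_one,
    mul_comm Complex.I, ← Complex.normSq_eq_norm_sq, Complex.normSq_add_mul_I]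

/-- The components of the curvature equation of a spiral curve in the moving frame
`(-b, a)`, `(i, 0)`, `(0, i)` are proportional to those of the velocity `(σ, a x, b y)`. The
second derivatives of the parameters `s, s₁, s₂` are `σ'`, `x'`, `y'`. -/
structure SpiralProportional (a b κ σ σ' x x' y y' : ℝ) : Prop where
  first : (σ' + a * b * (x ^ 2 - y ^ 2) + κ * (σ ^ 2 + (a * x) ^ 2 + (b * y) ^ 2)) * (a * x) =
    (-2 * b * σ * x + a * x') * σ
  second : (σ' + a * b * (x ^ 2 - y ^ 2) + κ * (σ ^ 2 + (a * x) ^ 2 + (b * y) ^ 2)) * (b * y) =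
    (2 * a * σ * y + b * y') * σ
  third : (-2 * b * σ * x + a * x') * (b * y) = (2 * a * σ * y + b * y') * (a * x)

/-- Eliminating `C` between `hC` and its derivative `hC'` gives the third minor, so `(A, B)` and `(a
x, b y)` are parallel. Cleared of denominators, the second ODE is `X r = σ (A a x + B b y)`, where
`X` is the first curvature component and `r = (a x)² + (b y)² > 0`. Together these give the two
minors involving `X`. -/
theorem SpiralProportional.of_ode {a b κ σ σ' x x' y y' C : ℝ} (hb : b ≠ 0) (hσ : σ ≠ 0)
    (hC : b ^ 2 * y = C * (a ^ 2 * x))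
    (hC' : 2 * a * b * σ * y + b ^ 2 * y' = C * (-2 * a * b * σ * x + a ^ 2 * x'))
    {Θ Θ' : ℝ} (hΘ : Θ = (a * (x / σ)) ^ 2 + (b * (y / σ)) ^ 2) (hpos : 0 < Θ)
    (hΘ' : Θ' = 2 * ((a * x) * ((-b * σ * x + a * x') * σ - a * x * σ')
      + (b * y) * ((a * σ * y + b * y') * σ - b * y * σ')) / σ ^ 3)
    (hode : -κ - a * b * ((x / σ) ^ 2 - (y / σ) ^ 2) / Θ = -(Θ' / σ / (2 * Θ * (1 + Θ)))) :
    SpiralProportional a b κ σ σ' x x' y y' := by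
  have h3 : (-2 * b * σ * x + a * x') * (b * y) = (2 * a * σ * y + b * y') * (a * x) := by
    apply mul_left_cancel₀ hb
    linear_combination (-2 * b * σ * x + a * x') * hC - a * x * hC'
  set r := (a * x) ^ 2 + (b * y) ^ 2 with hr
  have hΘr : Θ = r / σ ^ 2 := by rw [hΘ, hr]; field_simp
  have hrpos : 0 < r := by
    have : r = Θ * σ ^ 2 := by rw [hΘr]; field_simp
    rw [this]; positivity
  have hρ : 0 < σ ^ 2 + r := by positivity
  set A := -2 * b * σ * x + a * x' with hA
  set B := 2 * a * σ * y + b * y' with hB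
  have e1 : a * b * ((x / σ) ^ 2 - (y / σ) ^ 2) / Θ = a * b * (x ^ 2 - y ^ 2) / r := by
    rw [hΘr]; field_simp
  have e2 : Θ' / σ / (2 * Θ * (1 + Θ)) = ((a * x) * ((-b * σ * x + a * x') * σ - a * x * σ')
      + (b * y) * ((a * σ * y + b * y') * σ - b * y * σ')) / (r * (σ ^ 2 + r)) := by
    rw [hΘ', hΘr]; field_simp
  rw [e1, e2] at hode
  have hX : (σ' + a * b * (x ^ 2 - y ^ 2) + κ * (σ ^ 2 + r)) * r =
      σ * (A * (a * x) + B * (b * y)) := by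
    field_simp at hode
    rw [hA, hB, hr]
    rw [hr] at hode
    linear_combination (-1 : ℝ) * hode
  refine ⟨?_, ?_, h3⟩
  · apply mul_left_cancel₀ hrpos.ne'
    rw [add_assoc (σ ^ 2), ← hr]
    linear_combination (a * x) * hX - σ * (b * y) * h3 - σ * A * hr
  · apply mul_left_cancel₀ hrpos.ne'
    rw [add_assoc (σ ^ 2), ← hr]
    linear_combination (b * y) * hX + σ * (a * x) * h3 - σ * B * hr

/-- The velocity `(σ, a x, b y)` has squared length `ρ > 0`, so a parallel vector `(X, A, B)` is `m
/ ρ` times it, `m` being their inner product. Division of the curvature by `ρ` makes `μ = m / ρ²`.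
The coefficient `l` is the component of `(w₁, w₂)` along `(a, b)` in the orthonormal frame `(a, b)`,
`(-b, a)`. -/
theorem SpiralProportional.exists_combination {a b κ₁ κ₂ σ σ' x x' y y' : ℝ}
    (ha : a ≠ 0) (hb : b ≠ 0) (hab : a ^ 2 + b ^ 2 = 1)
    (h : SpiralProportional a b (κ₁ * (b / a) - κ₂ * (a / b)) σ σ' x x' y y')
    (hρ : 0 < σ ^ 2 + (a * x) ^ 2 + (b * y) ^ 2) :
    ∃ l μ : ℝ,
      ((-b * σ' - a * σ ^ 2) - a * x ^ 2) / (σ ^ 2 + (a * x) ^ 2 + (b * y) ^ 2) - κ₁ / a ^ 2 * a =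
        l * a + μ * (-b * σ) ∧
      (2 * (-b * σ) * x + a * x') / (σ ^ 2 + (a * x) ^ 2 + (b * y) ^ 2) = μ * (a * x) ∧
      ((a * σ' - b * σ ^ 2) - b * y ^ 2) / (σ ^ 2 + (a * x) ^ 2 + (b * y) ^ 2) - κ₂ / b ^ 2 * b =
        l * b + μ * (a * σ) ∧
      (2 * (a * σ) * y + b * y') / (σ ^ 2 + (a * x) ^ 2 + (b * y) ^ 2) = μ * (b * y) := by
  obtain ⟨h1, h2, h3⟩ := h
  set ρ := σ ^ 2 + (a * x) ^ 2 + (b * y) ^ 2 with hρdef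
  set κ := κ₁ * (b / a) - κ₂ * (a / b) with hκ
  set X := σ' + a * b * (x ^ 2 - y ^ 2) + κ * ρ with hX
  set A := -2 * b * σ * x + a * x' with hA
  set B := 2 * a * σ * y + b * y' with hB
  set w₁ := ((-b * σ' - a * σ ^ 2) - a * x ^ 2) / ρ - κ₁ / a ^ 2 * a with hw₁
  set w₂ := ((a * σ' - b * σ ^ 2) - b * y ^ 2) / ρ - κ₂ / b ^ 2 * b with hw₂
  set m := X * σ + A * (a * x) + B * (b * y) with hm
  have hXm : X * ρ = m * σ := by
    rw [hm, hρdef]; linear_combination (a * x) * h1 + (b * y) * h2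
  have hAm : A * ρ = m * (a * x) := by
    rw [hm, hρdef]; linear_combination (-σ) * h1 + (b * y) * h3
  have hBm : B * ρ = m * (b * y) := by
    rw [hm, hρdef]; linear_combination (-σ) * h2 - (a * x) * h3
  -- The terms `-κ₁ / a` and `-κ₂ / b` have component `κ` along `(-b, a)`; this is where the tangent
  -- and cotangent terms of the ODE come from.
  have hw : -b * w₁ + a * w₂ = X / ρ := by
    rw [hw₁, hw₂, hX, hκ]
    field_simp
    linear_combination σ' * a * b * hab
  have hXρ : X / ρ = m / ρ ^ 2 * σ := by
    field_simp; linear_combination hXm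
  refine ⟨a * w₁ + b * w₂, m / ρ ^ 2, ?_, ?_, ?_, ?_⟩
  · linear_combination (-w₁) * hab - b * hw - b * hXρ
  · field_simp; linear_combination hAm
  · linear_combination (-w₂) * hab + a * hw + a * hXρ
  · field_simp; linear_combination hBm

end Curves

/-! ### Both kinds of solution curves satisfy the proportionality -/

section SpiralCurves

variable {k₁ k₂ : ℕ} {C₁ : ℝ} {T : Set ℝ} {s s₁ s₂ : ℝ → ℝ}

theorem IsVaryingSolution.spiralProportional_of_deriv_ne_zero
    (h : IsVaryingSolution k₁ k₂ C₁ T s s₁ s₂) (hT : IsOpen T) (hs : ContDiffOn ℝ 2 s T)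
    (hs₁ : ContDiffOn ℝ 2 s₁ T) (hs₂ : ContDiffOn ℝ 2 s₂ T)
    (hmem : ∀ t ∈ T, s t ∈ Set.Ioo 0 (Real.pi / 2)) {t : ℝ} (ht : t ∈ T) (hne : deriv s t ≠ 0) :
    SpiralProportional (Real.cos (s t)) (Real.sin (s t))
      (k₁ * (Real.sin (s t) / Real.cos (s t)) - k₂ * (Real.cos (s t) / Real.sin (s t)))
      (deriv s t) (deriv (deriv s) t) (deriv s₁ t) (deriv (deriv s₁) t)
      (deriv s₂ t) (deriv (deriv s₂) t) := by
  have hb : 0 < Real.sin (s t) :=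
    Real.sin_pos_of_pos_of_lt_pi (hmem t ht).1 (by linarith [(hmem t ht).2, Real.pi_pos])
  have d0 := hs.hasDerivAt_of_two hT ht
  have d1 := hs.hasDerivAt_deriv_of_two hT ht
  have x1 := hs₁.hasDerivAt_deriv_of_two hT ht
  have y1 := hs₂.hasDerivAt_deriv_of_two hT ht
  -- `ds/dt` stays nonzero near `t`, so the first ODE, freed of its division by `ds/dt`, holds on a
  -- neighbourhood and can be differentiated.
  have hC : (fun u => Real.sin (s u) ^ 2 * deriv s₂ u) =ᶠ[𝓝 t]
      fun u => C₁ * (Real.cos (s u) ^ 2 * deriv s₁ u) := by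
    filter_upwards [hT.mem_nhds ht, d1.continuousAt.eventually_ne hne] with u hu hnu
    have := (h.2 u hu hnu).first
    simp only [derivWrt] at this
    field_simp at this
    linear_combination this
  have hC' : 2 * Real.cos (s t) * Real.sin (s t) * deriv s t * deriv s₂ t +
      Real.sin (s t) ^ 2 * deriv (deriv s₂) t =
      C₁ * (-2 * Real.cos (s t) * Real.sin (s t) * deriv s t * deriv s₁ t +
        Real.cos (s t) ^ 2 * deriv (deriv s₁) t) := by
    have hl := (d0.sin.pow 2).mul y1
    have hr := ((d0.cos.pow 2).mul x1).const_mul C₁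
    have := (hl.congr_of_eventuallyEq hC.symm).unique hr
    simp only [Pi.pow_apply] at this
    linear_combination this
  have ode := h.2 t ht hne
  refine SpiralProportional.of_ode (C := C₁) (Θ := spiralTheta s s₁ s₂ t)
    (Θ' := deriv (spiralTheta s s₁ s₂) t) hb.ne' hne hC.self_of_nhds hC' rfl ode.theta_pos ?_ ?_
  · have hΘ := ((d0.cos.mul (x1.div d1 hne)).pow 2).add ((d0.sin.mul (y1.div d1 hne)).pow 2)
    have : deriv (spiralTheta s s₁ s₂) t = _ := hΘ.deriv
    rw [this]
    simp only [Pi.mul_apply, Pi.div_apply, Nat.cast_ofNat, Nat.add_one_sub_one, pow_one]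
    field_simp
    ring
  · have := ode.second
    simp only [derivWrt] at this ⊢
    linear_combination this

/-- The minors involve no division by `ds/dt` and are continuous because the parameters are `C²`.
They hold on a punctured neighbourhood of each point, hence at the joints too. -/
theorem IsVaryingSolution.spiralProportional
    (h : IsVaryingSolution k₁ k₂ C₁ T s s₁ s₂) (hT : IsOpen T) (hs : ContDiffOn ℝ 2 s T)
    (hs₁ : ContDiffOn ℝ 2 s₁ T) (hs₂ : ContDiffOn ℝ 2 s₂ T)
    (hmem : ∀ t ∈ T, s t ∈ Set.Ioo 0 (Real.pi / 2)) {t : ℝ} (ht : t ∈ T) :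
    SpiralProportional (Real.cos (s t)) (Real.sin (s t))
      (k₁ * (Real.sin (s t) / Real.cos (s t)) - k₂ * (Real.cos (s t) / Real.sin (s t)))
      (deriv s t) (deriv (deriv s) t) (deriv s₁ t) (deriv (deriv s₁) t)
      (deriv s₂ t) (deriv (deriv s₂) t) := by
  have hb : Real.sin (s t) ≠ 0 :=
    (Real.sin_pos_of_pos_of_lt_pi (hmem t ht).1 (by linarith [(hmem t ht).2, Real.pi_pos])).ne'
  have ha : Real.cos (s t) ≠ 0 :=
    (Real.cos_pos_of_mem_Ioo ⟨by linarith [(hmem t ht).1, Real.pi_pos], (hmem t ht).2⟩).ne'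
  have c0 := (hs.hasDerivAt_of_two hT ht).continuousAt
  have c1 := (hs.hasDerivAt_deriv_of_two hT ht).continuousAt
  have x1 := (hs₁.hasDerivAt_deriv_of_two hT ht).continuousAt
  have y1 := (hs₂.hasDerivAt_deriv_of_two hT ht).continuousAt
  have c2 := (hs.continuousOn_deriv_deriv_of_two hT).continuousAt (hT.mem_nhds ht)
  have x2 := (hs₁.continuousOn_deriv_deriv_of_two hT).continuousAt (hT.mem_nhds ht)
  have y2 := (hs₂.continuousOn_deriv_deriv_of_two hT).continuousAt (hT.mem_nhds ht)
  have ca : ContinuousAt (fun u => Real.cos (s u)) t :=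
    Real.continuous_cos.continuousAt.comp c0
  have cb : ContinuousAt (fun u => Real.sin (s u)) t :=
    Real.continuous_sin.continuousAt.comp c0
  have hev : ∀ᶠ u in 𝓝[≠] t, SpiralProportional (Real.cos (s u)) (Real.sin (s u))
      (k₁ * (Real.sin (s u) / Real.cos (s u)) - k₂ * (Real.cos (s u) / Real.sin (s u)))
      (deriv s u) (deriv (deriv s) u) (deriv s₁ u) (deriv (deriv s₁) u)
      (deriv s₂ u) (deriv (deriv s₂) u) := by
    filter_upwards [h.1 t ht, nhdsWithin_le_nhds (hT.mem_nhds ht)] with u hu hu'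
    exact h.spiralProportional_of_deriv_ne_zero hT hs hs₁ hs₂ hmem hu' hu
  have key : ∀ {f g : ℝ → ℝ}, ContinuousAt f t → ContinuousAt g t → f =ᶠ[𝓝[≠] t] g →
      f t = g t := fun hf hg hfg =>
    ((hf.eventuallyEq_nhds_iff_eventuallyEq_nhdsNE hg).1 hfg).self_of_nhds
  refine ⟨key ?_ ?_ (hev.mono fun u hu => hu.first), key ?_ ?_ (hev.mono fun u hu => hu.second),
    key ?_ ?_ (hev.mono fun u hu => hu.third)⟩
  all_goals fun_prop (disch := assumption)

/-- The critical point equation of the function of the steady magnitudes. -/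
theorem steadyFunction_critical {σ : ℝ} (hσ : σ ∈ Set.Ioo 0 (Real.pi / 2))
    (hmin : IsMinOn (steadyFunction k₁ k₂ C₁) (Set.Ioo 0 (Real.pi / 2)) σ) :
    2 * (Real.cos σ * Real.sin σ) ^ 2 * (C₁ ^ 2 - 1) =
      (1 + (C₁ ^ 2 - 1) * Real.cos σ ^ 2) *
        ((2 * k₁ + 2) * Real.sin σ ^ 2 - (2 * k₂ + 2) * Real.cos σ ^ 2) := by
  have hb : 0 < Real.sin σ :=
    Real.sin_pos_of_pos_of_lt_pi hσ.1 (by linarith [hσ.2, Real.pi_pos])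
  have ha : 0 < Real.cos σ := Real.cos_pos_of_mem_Ioo ⟨by linarith [hσ.1, Real.pi_pos], hσ.2⟩
  have hlm : IsLocalMin (steadyFunction k₁ k₂ C₁) σ := hmin.isLocalMin (isOpen_Ioo.mem_nhds hσ)
  have hc := Real.hasDerivAt_cos σ
  have hs := Real.hasDerivAt_sin σ
  have hd := ((((hc.pow 2).const_mul (C₁ ^ 2 - 1)).const_add 1).div
    ((hc.pow (2 * k₁ + 2)).mul (hs.pow (2 * k₂ + 2))) (by
      simp only [Pi.mul_apply, Pi.pow_apply]; positivity))
  have h0 := hlm.hasDerivAt_eq_zero hd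
  rw [div_eq_zero_iff, or_iff_left (by simp only [Pi.mul_apply, Pi.pow_apply]; positivity)] at h0
  simp only [Pi.mul_apply, Pi.pow_apply] at h0
  have e1 : 2 * k₁ + 2 - 1 = 2 * k₁ + 1 := rfl
  have e2 : 2 * k₂ + 2 - 1 = 2 * k₂ + 1 := rfl
  rw [e1, e2] at h0
  push_cast at h0
  -- The common factor of the numerator of the derivative of the quotient.
  have hne : Real.cos σ ^ (2 * k₁ + 1) * Real.sin σ ^ (2 * k₂ + 1) ≠ 0 := by positivity
  apply mul_left_cancel₀ hne
  linear_combination (-1 : ℝ) * h0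

/-- With `s` constant, the first two minors follow from the vanishing of the first curvature
component, which is the critical point equation in disguise. The third comes from differentiating
the relation between `s₁'` and `s₂'`. The minimum enters only through criticality. -/
theorem IsSteadySolution.spiralProportional
    (h : IsSteadySolution k₁ k₂ C₁ T s s₁ s₂) (hT : IsOpen T)
    (hs₁ : ContDiffOn ℝ 2 s₁ T) (hs₂ : ContDiffOn ℝ 2 s₂ T)
    (hmem : ∀ t ∈ T, s t ∈ Set.Ioo 0 (Real.pi / 2)) {t : ℝ} (ht : t ∈ T) :
    SpiralProportional (Real.cos (s t)) (Real.sin (s t))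
      (k₁ * (Real.sin (s t) / Real.cos (s t)) - k₂ * (Real.cos (s t) / Real.sin (s t)))
      (deriv s t) (deriv (deriv s) t) (deriv s₁ t) (deriv (deriv s₁) t)
      (deriv s₂ t) (deriv (deriv s₂) t) := by
  obtain ⟨⟨σ, hσ, hmin, hconst⟩, hC⟩ := h
  have hb : 0 < Real.sin (s t) :=
    Real.sin_pos_of_pos_of_lt_pi (hmem t ht).1 (by linarith [(hmem t ht).2, Real.pi_pos])
  have ha : 0 < Real.cos (s t) :=
    Real.cos_pos_of_mem_Ioo ⟨by linarith [(hmem t ht).1, Real.pi_pos], (hmem t ht).2⟩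
  have hab := Real.sin_sq_add_cos_sq (s t)
  have hcrit := steadyFunction_critical hσ hmin
  have hds : ∀ u ∈ T, deriv s u = 0 := fun u hu => by
    have : s =ᶠ[𝓝 u] fun _ => σ := by filter_upwards [hT.mem_nhds hu] with v hv using hconst v hv
    rw [this.deriv_eq, deriv_const]
  have hdds : deriv (deriv s) t = 0 := by
    have : deriv s =ᶠ[𝓝 t] fun _ => 0 := by
      filter_upwards [hT.mem_nhds ht] with v hv using hds v hv
    rw [this.deriv_eq, deriv_const]
  have x1 := hs₁.hasDerivAt_deriv_of_two hT ht
  have y1 := hs₂.hasDerivAt_deriv_of_two hT ht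
  have hCt := hC t ht
  have hC' : Real.sin (s t) ^ 2 * deriv (deriv s₂) t =
      C₁ * (Real.cos (s t) ^ 2 * deriv (deriv s₁) t) := by
    have hl := y1.const_mul (Real.sin (s t) ^ 2)
    have hr := (x1.const_mul (Real.cos (s t) ^ 2)).const_mul C₁
    refine (hl.congr_of_eventuallyEq ?_).unique hr
    filter_upwards [hT.mem_nhds ht] with u hu
    have := hC u hu
    rw [hconst u hu, ← hconst t ht] at this
    exact this.symm
  rw [← hconst t ht] at hcrit
  rw [hdds, hds t ht]
  set a := Real.cos (s t)
  set b := Real.sin (s t)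
  set x := deriv s₁ t
  set y := deriv s₂ t
  have hX : a * b * (x ^ 2 - y ^ 2) +
      (k₁ * (b / a) - k₂ * (a / b)) * ((a * x) ^ 2 + (b * y) ^ 2) = 0 := by
    -- Besides clearing denominators, the extra `b ^ 2` turns each `y ^ 2` into `(b ^ 2 * y) ^ 2`,
    -- which `hCt` expresses through `x`.
    have e : (a * b * b ^ 2) * (a * b * (x ^ 2 - y ^ 2) +
        (k₁ * (b / a) - k₂ * (a / b)) * ((a * x) ^ 2 + (b * y) ^ 2)) =
        b ^ 2 * (a ^ 2 * b ^ 2 * (x ^ 2 - y ^ 2) +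
          (k₁ * b ^ 2 - k₂ * a ^ 2) * (a ^ 2 * x ^ 2 + b ^ 2 * y ^ 2)) := by
      field_simp
    refine (mul_eq_zero.1 (e.trans ?_)).resolve_left (by positivity)
    linear_combination (-a ^ 2 + (k₁ * b ^ 2 - k₂ * a ^ 2)) * (b ^ 2 * y + C₁ * (a ^ 2 * x)) * hCt
      + a ^ 2 * x ^ 2 * (-(1 / 2) * hcrit + ((k₁ * b ^ 2 - k₂ * a ^ 2) + b ^ 2 - a ^ 2) * hab)
  refine ⟨?_, ?_, ?_⟩
  · linear_combination (a * x) * hX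
  · linear_combination (b * y) * hX
  · apply mul_left_cancel₀ hb.ne'
    linear_combination (a * deriv (deriv s₁) t) * hCt - a * x * hC'

/-- The data of a spiral curve used for the minimality of the spiral minimal product. -/
theorem IsSpiralCurve.exists_combination {γ₁ γ₂ : ℝ → ℂ} (h : IsSpiralCurve k₁ k₂ T γ₁ γ₂) :
    ContDiffOn ℝ 2 γ₁ T ∧ ContDiffOn ℝ 2 γ₂ T ∧ ∀ t ∈ T,
      γ₁ t ≠ 0 ∧ γ₂ t ≠ 0 ∧ ‖γ₁ t‖ ^ 2 + ‖γ₂ t‖ ^ 2 = 1 ∧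
      0 < ‖deriv γ₁ t‖ ^ 2 + ‖deriv γ₂ t‖ ^ 2 ∧
      ∃ l μ : ℝ,
        (‖deriv γ₁ t‖ ^ 2 + ‖deriv γ₂ t‖ ^ 2)⁻¹ • deriv (deriv γ₁) t
            - (k₁ / ‖γ₁ t‖ ^ 2) • γ₁ t = l • γ₁ t + μ • deriv γ₁ t ∧
        (‖deriv γ₁ t‖ ^ 2 + ‖deriv γ₂ t‖ ^ 2)⁻¹ • deriv (deriv γ₂) t
            - (k₂ / ‖γ₂ t‖ ^ 2) • γ₂ t = l • γ₂ t + μ • deriv γ₂ t := by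
  obtain ⟨hT, -, C₁, s, s₁, s₂, hs, hs₁, hs₂, hmem, hγ₁, hγ₂, himm, hsol⟩ := h
  have hcos : ContDiffOn ℝ 2 (fun u => Real.cos (s u)) T := Real.contDiff_cos.comp_contDiffOn hs
  have hsin : ContDiffOn ℝ 2 (fun u => Real.sin (s u)) T := Real.contDiff_sin.comp_contDiffOn hs
  have hpolar : ∀ {r θ : ℝ → ℝ}, ContDiffOn ℝ 2 r T → ContDiffOn ℝ 2 θ T →
      ContDiffOn ℝ 2 (fun t => (r t : ℂ) * Complex.exp (Complex.I * (θ t : ℂ))) T := by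
    intro r θ hr hθ
    have hr' : ContDiffOn ℝ 2 (fun t => (r t : ℂ)) T :=
      Complex.ofRealCLM.contDiff.comp_contDiffOn hr
    have hθ' : ContDiffOn ℝ 2 (fun t => (θ t : ℂ)) T :=
      Complex.ofRealCLM.contDiff.comp_contDiffOn hθ
    exact hr'.mul (contDiffOn_const.mul hθ').cexp
  refine ⟨(hpolar hcos hs₁).congr hγ₁, (hpolar hsin hs₂).congr hγ₂, fun t ht => ?_⟩
  have hb : 0 < Real.sin (s t) :=
    Real.sin_pos_of_pos_of_lt_pi (hmem t ht).1 (by linarith [(hmem t ht).2, Real.pi_pos])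
  have ha : 0 < Real.cos (s t) :=
    Real.cos_pos_of_mem_Ioo ⟨by linarith [(hmem t ht).1, Real.pi_pos], (hmem t ht).2⟩
  have hab := Real.cos_sq_add_sin_sq (s t)
  have dcos : ∀ u ∈ T, deriv (fun u => Real.cos (s u)) u = -Real.sin (s u) * deriv s u :=
    fun u hu => ((hs.hasDerivAt_of_two hT hu).cos).deriv
  have dsin : ∀ u ∈ T, deriv (fun u => Real.sin (s u)) u = Real.cos (s u) * deriv s u :=
    fun u hu => ((hs.hasDerivAt_of_two hT hu).sin).deriv
  have d0 := hs.hasDerivAt_of_two hT ht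
  have d1 := hs.hasDerivAt_deriv_of_two hT ht
  have ddcos : deriv (deriv (fun u => Real.cos (s u))) t =
      -Real.sin (s t) * deriv (deriv s) t - Real.cos (s t) * deriv s t ^ 2 := by
    have : deriv (fun u => Real.cos (s u)) =ᶠ[𝓝 t] fun u => -Real.sin (s u) * deriv s u := by
      filter_upwards [hT.mem_nhds ht] with u hu using dcos u hu
    rw [this.deriv_eq]
    refine ((d0.sin.neg).mul d1).deriv.trans ?_
    simp only [Pi.neg_apply]
    ring
  have ddsin : deriv (deriv (fun u => Real.sin (s u))) t =
      Real.cos (s t) * deriv (deriv s) t - Real.sin (s t) * deriv s t ^ 2 := by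
    have : deriv (fun u => Real.sin (s u)) =ᶠ[𝓝 t] fun u => Real.cos (s u) * deriv s u := by
      filter_upwards [hT.mem_nhds ht] with u hu using dsin u hu
    rw [this.deriv_eq]
    refine (d0.cos.mul d1).deriv.trans ?_
    ring
  have hsp := hsol.elim (fun h => h.spiralProportional hT hs hs₁ hs₂ hmem ht)
    (fun h => h.spiralProportional hT hs₁ hs₂ hmem ht)
  have g1 := deriv_polar hT hcos hs₁ hγ₁ ht
  have g2 := deriv_polar hT hsin hs₂ hγ₂ ht
  have gg1 := deriv_deriv_polar hT hcos hs₁ hγ₁ ht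
  have gg2 := deriv_deriv_polar hT hsin hs₂ hγ₂ ht
  rw [ddcos, dcos t ht] at gg1
  rw [ddsin, dsin t ht] at gg2
  rw [dcos t ht] at g1
  rw [dsin t ht] at g2
  have n1 : ‖γ₁ t‖ ^ 2 = Real.cos (s t) ^ 2 := by
    have := norm_mul_exp_I_sq (Real.cos (s t)) 0 (s₁ t)
    simpa [hγ₁ t ht] using this
  have n2 : ‖γ₂ t‖ ^ 2 = Real.sin (s t) ^ 2 := by
    have := norm_mul_exp_I_sq (Real.sin (s t)) 0 (s₂ t)
    simpa [hγ₂ t ht] using this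
  have m : ‖deriv γ₁ t‖ ^ 2 + ‖deriv γ₂ t‖ ^ 2 = deriv s t ^ 2 +
      (Real.cos (s t) * deriv s₁ t) ^ 2 + (Real.sin (s t) * deriv s₂ t) ^ 2 := by
    rw [g1, g2, ← Complex.ofReal_mul, ← Complex.ofReal_mul, norm_mul_exp_I_sq, norm_mul_exp_I_sq]
    linear_combination (deriv s t ^ 2) * hab
  have hpos : 0 < ‖deriv γ₁ t‖ ^ 2 + ‖deriv γ₂ t‖ ^ 2 := by
    rcases himm t ht with h | h
    · have := norm_pos_iff.2 h
      positivity
    · have := norm_pos_iff.2 h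
      positivity
  refine ⟨?_, ?_, by rw [n1, n2, hab], hpos, ?_⟩
  · have : ‖γ₁ t‖ ^ 2 ≠ 0 := by rw [n1]; positivity
    exact fun h0 => this (by simp [h0])
  · have : ‖γ₂ t‖ ^ 2 ≠ 0 := by rw [n2]; positivity
    exact fun h0 => this (by simp [h0])
  obtain ⟨l, μ, e1, e2, e3, e4⟩ := hsp.exists_combination ha.ne' hb.ne' hab (m ▸ hpos)
  refine ⟨l, μ, ?_, ?_⟩
  -- The real equations `e1` and `e2` are the components along `e^{i s₁}` and `i e^{i s₁}`; likewise
  -- `e3` and `e4` for the second factor.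
  · rw [m, n1, gg1, g1, hγ₁ t ht]
    have e1' := congrArg (fun z : ℝ => (z : ℂ)) e1
    have e2' := congrArg (fun z : ℝ => (z : ℂ)) e2
    simp only [Complex.real_smul]
    push_cast at e1' e2' ⊢
    linear_combination (Complex.exp (Complex.I * (s₁ t : ℂ))) * e1' +
      (Complex.I * Complex.exp (Complex.I * (s₁ t : ℂ))) * e2'
  · rw [m, n2, gg2, g2, hγ₂ t ht]
    have e3' := congrArg (fun z : ℝ => (z : ℂ)) e3
    have e4' := congrArg (fun z : ℝ => (z : ℂ)) e4
    simp only [Complex.real_smul]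
    push_cast at e3' e4' ⊢
    linear_combination (Complex.exp (Complex.I * (s₂ t : ℂ))) * e3' +
      (Complex.I * Complex.exp (Complex.I * (s₂ t : ℂ))) * e4'

end SpiralCurves

/-! ### Real inner products of complex multiples -/

section ComplexInner

variable {m : ℕ}

/-- Only the pairings of `y` with `x` and with `i x` enter. For `x` a position vector and `y`
tangent, sphericity kills the first and the `C`-totally real condition the second. -/
theorem inner_smul_smul_eq (z w : ℂ) (x y : EuclideanSpace ℂ (Fin m)) :
    inner ℝ (z • x) (w • y) = (starRingEnd ℂ z * w).re * inner ℝ x y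
      - (starRingEnd ℂ z * w).im * inner ℝ (Complex.I • x) y := by
  simp only [PiLp.inner_apply, PiLp.smul_apply, Complex.inner, smul_eq_mul, Finset.mul_sum,
    ← Finset.sum_sub_distrib]
  refine Finset.sum_congr rfl fun i _ => ?_
  simp only [map_mul, Complex.mul_re, Complex.mul_im, Complex.conj_re, Complex.conj_im,
    Complex.I_re, Complex.I_im]
  ring

theorem inner_smul_smul_same (z : ℂ) (x y : EuclideanSpace ℂ (Fin m)) :
    inner ℝ (z • x) (z • y) = ‖z‖ ^ 2 * inner ℝ x y := by
  rw [inner_smul_smul_eq, ← Complex.normSq_eq_conj_mul_self, Complex.normSq_eq_norm_sq,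
    Complex.ofReal_re, Complex.ofReal_im, zero_mul, sub_zero]

/-- The inner product of velocities of a complex warped curve `c x` in a cone. -/
theorem inner_velocity {c z : ℂ} {x ξ ξ' : EuclideanSpace ℂ (Fin m)} (hx : ‖x‖ = 1)
    (h : inner ℝ x ξ = 0) (hI : inner ℝ (Complex.I • x) ξ = 0)
    (h' : inner ℝ x ξ' = 0) (hI' : inner ℝ (Complex.I • x) ξ' = 0) (r r' : ℝ) :
    inner ℝ (r • z • x + c • ξ) (r' • z • x + c • ξ') =
      ‖z‖ ^ 2 * (r * r') + ‖c‖ ^ 2 * inner ℝ ξ ξ' := by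
  have e : inner ℝ (z • x) (c • ξ') = 0 := by rw [inner_smul_smul_eq, h', hI']; ring
  have e' : inner ℝ (c • ξ) (z • x) = 0 := by
    rw [real_inner_comm, inner_smul_smul_eq, h, hI]; ring
  rw [inner_add_left, inner_add_right, inner_add_right, real_inner_smul_left, real_inner_smul_left,
    real_inner_smul_right, real_inner_smul_right, e, e', inner_smul_smul_same, inner_smul_smul_same,
    real_inner_self_eq_norm_sq, hx]
  ring

end ComplexInner

/-! ### First and second derivatives of the product in flat coordinates -/

section Derivatives

variable {m₁ m₂ : ℕ} {E₁ : Type*} [NormedAddCommGroup E₁] [NormedSpace ℝ E₁]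
  {E₂ : Type*} [NormedAddCommGroup E₂] [NormedSpace ℝ E₂]
  {c₁ c₂ : ℝ → ℂ} {A : E₁ → EuclideanSpace ℂ (Fin m₁)} {B : E₂ → EuclideanSpace ℂ (Fin m₂)}

theorem spiralProduct_hasFDerivAt {c₁' c₂' : ℂ} {A' : E₁ →L[ℝ] EuclideanSpace ℂ (Fin m₁)}
    {B' : E₂ →L[ℝ] EuclideanSpace ℂ (Fin m₂)} {q : ℝ × (E₁ × E₂)}
    (hc₁ : HasDerivAt c₁ c₁' q.1) (hc₂ : HasDerivAt c₂ c₂' q.1)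
    (hA : HasFDerivAt A A' q.2.1) (hB : HasFDerivAt B B' q.2.2) :
    ∃ D : ℝ × (E₁ × E₂) →L[ℝ] WithLp 2 (EuclideanSpace ℂ (Fin m₁) × EuclideanSpace ℂ (Fin m₂)),
      HasFDerivAt (spiralProduct c₁ c₂ A B) D q ∧
      ∀ v, D v = WithLp.toLp 2 (v.1 • c₁' • A q.2.1 + c₁ q.1 • A' v.2.1,
        v.1 • c₂' • B q.2.2 + c₂ q.1 • B' v.2.2) := by
  have p1 : HasFDerivAt (𝕜 := ℝ) (fun q : ℝ × (E₁ × E₂) => q.1) _ q := hasFDerivAt_fst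
  have p2 : HasFDerivAt (𝕜 := ℝ) (fun q : ℝ × (E₁ × E₂) => q.2.1) _ q :=
    (hasFDerivAt_snd (𝕜 := ℝ) (p := q)).fst
  have p3 : HasFDerivAt (𝕜 := ℝ) (fun q : ℝ × (E₁ × E₂) => q.2.2) _ q :=
    (hasFDerivAt_snd (𝕜 := ℝ) (p := q)).snd
  have h1 := (hc₁.hasFDerivAt.comp q p1).smul (hA.comp q p2)
  have h2 := (hc₂.hasFDerivAt.comp q p1).smul (hB.comp q p3)
  have h := (WithLp.prodContinuousLinearEquiv 2 ℝ (EuclideanSpace ℂ (Fin m₁))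
    (EuclideanSpace ℂ (Fin m₂))).symm.hasFDerivAt.comp q (h1.prodMk h2)
  refine ⟨_, h, fun v => ?_⟩
  change WithLp.toLp 2 (c₁ q.1 • A' v.2.1 + (v.1 • c₁') • A q.2.1,
    c₂ q.1 • B' v.2.2 + (v.1 • c₂') • B q.2.2) = _
  rw [smul_assoc, smul_assoc, add_comm (c₁ q.1 • _), add_comm (c₂ q.1 • _)]

theorem fderiv_spiralProduct {q : ℝ × (E₁ × E₂)}
    (hc₁ : DifferentiableAt ℝ c₁ q.1) (hc₂ : DifferentiableAt ℝ c₂ q.1)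
    (hA : DifferentiableAt ℝ A q.2.1) (hB : DifferentiableAt ℝ B q.2.2) (v : ℝ × (E₁ × E₂)) :
    fderiv ℝ (spiralProduct c₁ c₂ A B) q v =
      WithLp.toLp 2 (v.1 • deriv c₁ q.1 • A q.2.1 + c₁ q.1 • fderiv ℝ A q.2.1 v.2.1,
        v.1 • deriv c₂ q.1 • B q.2.2 + c₂ q.1 • fderiv ℝ B q.2.2 v.2.2) := by
  obtain ⟨D, hD, hv⟩ := spiralProduct_hasFDerivAt hc₁.hasDerivAt hc₂.hasDerivAt hA.hasFDerivAt
    hB.hasFDerivAt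
  rw [hD.fderiv, hv]

theorem spiralProduct_contDiffAt {n : ℕ∞ω} {q : ℝ × (E₁ × E₂)}
    (hc₁ : ContDiffAt ℝ n c₁ q.1) (hc₂ : ContDiffAt ℝ n c₂ q.1)
    (hA : ContDiffAt ℝ n A q.2.1) (hB : ContDiffAt ℝ n B q.2.2) :
    ContDiffAt ℝ n (spiralProduct c₁ c₂ A B) q := by
  have p1 : ContDiffAt ℝ n (fun q : ℝ × (E₁ × E₂) => q.1) q := contDiffAt_fst
  have p2 : ContDiffAt ℝ n (fun q : ℝ × (E₁ × E₂) => q.2.1) q := contDiffAt_snd.fst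
  have p3 : ContDiffAt ℝ n (fun q : ℝ × (E₁ × E₂) => q.2.2) q := contDiffAt_snd.snd
  have h1 := (hc₁.comp q p1).smul (hA.comp q p2)
  have h2 := (hc₂.comp q p1).smul (hB.comp q p3)
  exact (WithLp.prodContinuousLinearEquiv 2 ℝ (EuclideanSpace ℂ (Fin m₁))
    (EuclideanSpace ℂ (Fin m₂))).symm.contDiff.contDiffAt.comp q (h1.prodMk h2)

theorem inner_fderiv_spiralProduct {q : ℝ × (E₁ × E₂)}
    (hc₁ : DifferentiableAt ℝ c₁ q.1) (hc₂ : DifferentiableAt ℝ c₂ q.1)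
    (hA : DifferentiableAt ℝ A q.2.1) (hB : DifferentiableAt ℝ B q.2.2)
    (hA1 : ‖A q.2.1‖ = 1) (hB1 : ‖B q.2.2‖ = 1)
    (hA' : ∀ ξ, inner ℝ (A q.2.1) (fderiv ℝ A q.2.1 ξ) = 0)
    (hB' : ∀ η, inner ℝ (B q.2.2) (fderiv ℝ B q.2.2 η) = 0)
    (hAI : ∀ ξ, inner ℝ (Complex.I • A q.2.1) (fderiv ℝ A q.2.1 ξ) = 0)
    (hBI : ∀ η, inner ℝ (Complex.I • B q.2.2) (fderiv ℝ B q.2.2 η) = 0) (v w : ℝ × (E₁ × E₂)) :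
    inner ℝ (fderiv ℝ (spiralProduct c₁ c₂ A B) q v) (fderiv ℝ (spiralProduct c₁ c₂ A B) q w) =
      (‖deriv c₁ q.1‖ ^ 2 + ‖deriv c₂ q.1‖ ^ 2) * (v.1 * w.1) +
        ‖c₁ q.1‖ ^ 2 * inner ℝ (fderiv ℝ A q.2.1 v.2.1) (fderiv ℝ A q.2.1 w.2.1) +
        ‖c₂ q.1‖ ^ 2 * inner ℝ (fderiv ℝ B q.2.2 v.2.2) (fderiv ℝ B q.2.2 w.2.2) := by
  rw [fderiv_spiralProduct hc₁ hc₂ hA hB, fderiv_spiralProduct hc₁ hc₂ hA hB,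
    WithLp.prod_inner_apply]
  change inner ℝ (_ : EuclideanSpace ℂ (Fin m₁)) _ + inner ℝ (_ : EuclideanSpace ℂ (Fin m₂)) _ = _
  rw [inner_velocity hA1 (hA' _) (hAI _) (hA' _) (hAI _),
    inner_velocity hB1 (hB' _) (hBI _) (hB' _) (hBI _)]
  ring

variable {ι₁ ι₂ : Type*} [Fintype ι₁] [DecidableEq ι₁] [Fintype ι₂] [DecidableEq ι₂]
  (b₁ : Module.Basis ι₁ ℝ E₁) (b₂ : Module.Basis ι₂ ℝ E₂)

theorem inv_fromBlocks_diagonal {l n : Type*} [Fintype l] [DecidableEq l] [Fintype n]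
    [DecidableEq n] {P P' : Matrix l l ℝ} {Q Q' : Matrix n n ℝ} (hP : P * P' = 1)
    (hQ : Q * Q' = 1) :
    (Matrix.fromBlocks P 0 0 Q)⁻¹ = Matrix.fromBlocks P' 0 0 Q' := by
  refine Matrix.inv_eq_right_inv ?_
  rw [Matrix.fromBlocks_multiply]
  simp [hP, hQ]

/-- The trace of the second derivative of a spiral product, in product coordinates. -/
theorem trace_fderiv_fderiv_spiralProduct {q : ℝ × (E₁ × E₂)}
    (hc₁ : ContDiffAt ℝ 2 c₁ q.1) (hc₂ : ContDiffAt ℝ 2 c₂ q.1)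
    (hA : ContDiffAt ℝ 2 A q.2.1) (hB : ContDiffAt ℝ 2 B q.2.2)
    (hA1 : ‖A q.2.1‖ = 1) (hB1 : ‖B q.2.2‖ = 1)
    (hA' : ∀ ξ, inner ℝ (A q.2.1) (fderiv ℝ A q.2.1 ξ) = 0)
    (hB' : ∀ η, inner ℝ (B q.2.2) (fderiv ℝ B q.2.2 η) = 0)
    (hAI : ∀ ξ, inner ℝ (Complex.I • A q.2.1) (fderiv ℝ A q.2.1 ξ) = 0)
    (hBI : ∀ η, inner ℝ (Complex.I • B q.2.2) (fderiv ℝ B q.2.2 η) = 0)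
    (hAli : LinearIndependent ℝ fun i => fderiv ℝ A q.2.1 (b₁ i))
    (hBli : LinearIndependent ℝ fun i => fderiv ℝ B q.2.2 (b₂ i))
    (hc₁0 : c₁ q.1 ≠ 0) (hc₂0 : c₂ q.1 ≠ 0)
    (hρ : 0 < ‖deriv c₁ q.1‖ ^ 2 + ‖deriv c₂ q.1‖ ^ 2) :
    ∑ i, ∑ j, (Matrix.gram ℝ fun i => fderiv ℝ (spiralProduct c₁ c₂ A B) q
        ((Module.Basis.singleton Unit ℝ).prod (b₁.prod b₂) i))⁻¹ i j •
      fderiv ℝ (fun u => fderiv ℝ (spiralProduct c₁ c₂ A B) u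
        ((Module.Basis.singleton Unit ℝ).prod (b₁.prod b₂) j)) q
        ((Module.Basis.singleton Unit ℝ).prod (b₁.prod b₂) i) =
    WithLp.toLp 2
      ((‖deriv c₁ q.1‖ ^ 2 + ‖deriv c₂ q.1‖ ^ 2)⁻¹ • deriv (deriv c₁) q.1 • A q.2.1 +
        (‖c₁ q.1‖ ^ 2)⁻¹ • c₁ q.1 • ∑ i, ∑ j,
          (Matrix.gram ℝ fun i => fderiv ℝ A q.2.1 (b₁ i))⁻¹ i j •
            fderiv ℝ (fun u => fderiv ℝ A u (b₁ j)) q.2.1 (b₁ i),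
      (‖deriv c₁ q.1‖ ^ 2 + ‖deriv c₂ q.1‖ ^ 2)⁻¹ • deriv (deriv c₂) q.1 • B q.2.2 +
        (‖c₂ q.1‖ ^ 2)⁻¹ • c₂ q.1 • ∑ i, ∑ j,
          (Matrix.gram ℝ fun i => fderiv ℝ B q.2.2 (b₂ i))⁻¹ i j •
            fderiv ℝ (fun u => fderiv ℝ B u (b₂ j)) q.2.2 (b₂ i)) := by
  have dc₁ := hc₁.differentiableAt two_ne_zero
  have dc₂ := hc₂.differentiableAt two_ne_zero
  have dA := hA.differentiableAt two_ne_zero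
  have dB := hB.differentiableAt two_ne_zero
  set b := (Module.Basis.singleton Unit ℝ).prod (b₁.prod b₂) with hb
  have b0 : ∀ i, b (Sum.inl i) = ((1 : ℝ), ((0 : E₁), (0 : E₂))) := fun i => by
    simp [hb]
    rfl
  have bl : ∀ i, b (Sum.inr (Sum.inl i)) = ((0 : ℝ), (b₁ i, (0 : E₂))) := fun i => by simp [hb]
  have br : ∀ i, b (Sum.inr (Sum.inr i)) = ((0 : ℝ), ((0 : E₁), b₂ i)) := fun i => by simp [hb]
  set ρ := ‖deriv c₁ q.1‖ ^ 2 + ‖deriv c₂ q.1‖ ^ 2 with hρdef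
  set g₁ := Matrix.gram ℝ fun i => fderiv ℝ A q.2.1 (b₁ i) with hg₁
  set g₂ := Matrix.gram ℝ fun i => fderiv ℝ B q.2.2 (b₂ i) with hg₂
  have n1 : ‖c₁ q.1‖ ^ 2 ≠ 0 := pow_ne_zero _ (norm_ne_zero_iff.2 hc₁0)
  have n2 : ‖c₂ q.1‖ ^ 2 ≠ 0 := pow_ne_zero _ (norm_ne_zero_iff.2 hc₂0)
  -- The three coordinate blocks are mutually orthogonal, so mixed second derivatives never
  -- contribute to the trace and only those within a block are computed below.
  have hgram : (Matrix.gram ℝ fun i => fderiv ℝ (spiralProduct c₁ c₂ A B) q (b i)) =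
      Matrix.fromBlocks (ρ • (1 : Matrix Unit Unit ℝ)) 0 0
        (Matrix.fromBlocks (‖c₁ q.1‖ ^ 2 • g₁) 0 0 (‖c₂ q.1‖ ^ 2 • g₂)) := by
    ext i j
    rw [Matrix.gram_apply,
      inner_fderiv_spiralProduct dc₁ dc₂ dA dB hA1 hB1 hA' hB' hAI hBI]
    rcases i with i | i | i <;> rcases j with j | j | j <;>
      simp [b0, bl, br, hg₁, hg₂, hρdef]
  have d1 : g₁ * g₁⁻¹ = 1 := Matrix.mul_nonsing_inv _
    (Matrix.posDef_gram_of_linearIndependent hAli).det_pos.ne'.isUnit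
  have d2 : g₂ * g₂⁻¹ = 1 := Matrix.mul_nonsing_inv _
    (Matrix.posDef_gram_of_linearIndependent hBli).det_pos.ne'.isUnit
  have hinv : (Matrix.gram ℝ fun i => fderiv ℝ (spiralProduct c₁ c₂ A B) q (b i))⁻¹ =
      Matrix.fromBlocks (ρ⁻¹ • (1 : Matrix Unit Unit ℝ)) 0 0
        (Matrix.fromBlocks ((‖c₁ q.1‖ ^ 2)⁻¹ • g₁⁻¹) 0 0 ((‖c₂ q.1‖ ^ 2)⁻¹ • g₂⁻¹)) := by
    rw [hgram]
    refine inv_fromBlocks_diagonal ?_ ?_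
    · rw [smul_mul_smul_comm, mul_inv_cancel₀ hρ.ne', one_smul, one_mul]
    · rw [Matrix.fromBlocks_multiply]
      simp [smul_smul, inv_mul_cancel₀ n1, inv_mul_cancel₀ n2, d1, d2]
  have hfst : Filter.Tendsto (fun u : ℝ × (E₁ × E₂) => u.1) (𝓝 q) (𝓝 q.1) :=
    continuous_fst.continuousAt
  have hsl : Filter.Tendsto (fun u : ℝ × (E₁ × E₂) => u.2.1) (𝓝 q) (𝓝 q.2.1) :=
    (continuous_fst.comp continuous_snd).continuousAt
  have hsr : Filter.Tendsto (fun u : ℝ × (E₁ × E₂) => u.2.2) (𝓝 q) (𝓝 q.2.2) :=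
    (continuous_snd.comp continuous_snd).continuousAt
  have hev : ∀ᶠ u in 𝓝 q, ∀ v, fderiv ℝ (spiralProduct c₁ c₂ A B) u v =
      WithLp.toLp 2 (v.1 • deriv c₁ u.1 • A u.2.1 + c₁ u.1 • fderiv ℝ A u.2.1 v.2.1,
        v.1 • deriv c₂ u.1 • B u.2.2 + c₂ u.1 • fderiv ℝ B u.2.2 v.2.2) := by
    filter_upwards [hfst.eventually (hc₁.eventually (by simp)),
      hfst.eventually (hc₂.eventually (by simp)), hsl.eventually (hA.eventually (by simp)),
      hsr.eventually (hB.eventually (by simp))] with u h1 h2 h3 h4 v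
    exact fderiv_spiralProduct (h1.differentiableAt two_ne_zero) (h2.differentiableAt two_ne_zero)
      (h3.differentiableAt two_ne_zero) (h4.differentiableAt two_ne_zero) v
  have ddc : ∀ {c : ℝ → ℂ}, ContDiffAt ℝ 2 c q.1 → DifferentiableAt ℝ (deriv c) q.1 :=
    fun hc => ((hc.fderiv_right (m := 1) le_rfl).differentiableAt one_ne_zero).clm_apply
      (differentiableAt_const 1)
  have ddA : ∀ ξ, DifferentiableAt ℝ (fun u => fderiv ℝ A u ξ) q.2.1 := fun ξ =>
    ((hA.fderiv_right (m := 1) le_rfl).differentiableAt one_ne_zero).clm_apply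
      (differentiableAt_const _)
  have ddB : ∀ ξ, DifferentiableAt ℝ (fun u => fderiv ℝ B u ξ) q.2.2 := fun ξ =>
    ((hB.fderiv_right (m := 1) le_rfl).differentiableAt one_ne_zero).clm_apply
      (differentiableAt_const _)
  -- Each partial derivative of a spiral product is locally again one: along the curve `(c₁', c₂')`
  -- in the `t` direction, and with one map differentiated and the other zero in the remaining
  -- directions. The first derivative formula thus serves twice.
  have H0 : ∀ i j, fderiv ℝ (fun u => fderiv ℝ (spiralProduct c₁ c₂ A B) u (b (Sum.inl j))) q
      (b (Sum.inl i)) = WithLp.toLp 2 (deriv (deriv c₁) q.1 • A q.2.1,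
        deriv (deriv c₂) q.1 • B q.2.2) := fun i j => by
    have : (fun u => fderiv ℝ (spiralProduct c₁ c₂ A B) u (b (Sum.inl j))) =ᶠ[𝓝 q]
        spiralProduct (deriv c₁) (deriv c₂) A B := by
      filter_upwards [hev] with u hu
      rw [hu, b0]
      simp [spiralProduct]
    rw [this.fderiv_eq, fderiv_spiralProduct (ddc hc₁) (ddc hc₂) dA dB, b0]
    simp
  have Hl : ∀ i j, fderiv ℝ (fun u => fderiv ℝ (spiralProduct c₁ c₂ A B) u
      (b (Sum.inr (Sum.inl j)))) q (b (Sum.inr (Sum.inl i))) =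
      WithLp.toLp 2 (c₁ q.1 • fderiv ℝ (fun u => fderiv ℝ A u (b₁ j)) q.2.1 (b₁ i), 0) :=
    fun i j => by
    have : (fun u => fderiv ℝ (spiralProduct c₁ c₂ A B) u (b (Sum.inr (Sum.inl j)))) =ᶠ[𝓝 q]
        spiralProduct c₁ c₂ (fun u => fderiv ℝ A u (b₁ j)) fun _ => 0 := by
      filter_upwards [hev] with u hu
      rw [hu, bl]
      simp [spiralProduct]
    rw [this.fderiv_eq, fderiv_spiralProduct dc₁ dc₂ (ddA _) (differentiableAt_const _), bl]
    simp
  have Hr : ∀ i j, fderiv ℝ (fun u => fderiv ℝ (spiralProduct c₁ c₂ A B) u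
      (b (Sum.inr (Sum.inr j)))) q (b (Sum.inr (Sum.inr i))) =
      WithLp.toLp 2 (0, c₂ q.1 • fderiv ℝ (fun u => fderiv ℝ B u (b₂ j)) q.2.2 (b₂ i)) :=
    fun i j => by
    have : (fun u => fderiv ℝ (spiralProduct c₁ c₂ A B) u (b (Sum.inr (Sum.inr j)))) =ᶠ[𝓝 q]
        spiralProduct c₁ c₂ (fun _ => 0) fun u => fderiv ℝ B u (b₂ j) := by
      filter_upwards [hev] with u hu
      rw [hu, br]
      simp [spiralProduct]
    rw [this.fderiv_eq, fderiv_spiralProduct dc₁ dc₂ (differentiableAt_const _) (ddB _), br]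
    simp
  rw [hinv]
  simp only [Fintype.sum_sum_type, Matrix.fromBlocks_apply₁₁, Matrix.fromBlocks_apply₁₂,
    Matrix.fromBlocks_apply₂₁, Matrix.fromBlocks_apply₂₂, Matrix.zero_apply, zero_smul,
    Finset.sum_const_zero, add_zero, zero_add, H0, Hl, Hr, Matrix.smul_apply, smul_assoc,
    ← Finset.smul_sum]
  refine WithLp.ofLp_injective 2 (Prod.ext ?_ ?_)
  · simp [WithLp.ofLp_sum, Prod.fst_sum, Finset.smul_sum, smul_comm (c₁ q.1)]
  · simp [WithLp.ofLp_sum, Prod.snd_sum, Finset.smul_sum, smul_comm (c₂ q.1)]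

end Derivatives

/-! ### Maps into spheres and into products of normed spaces -/

section UnitMaps

variable {E : Type*} [NormedAddCommGroup E] [NormedSpace ℝ E]
  {H : Type*} [TopologicalSpace H] (I : ModelWithCorners ℝ E H) [I.Boundaryless]
  {M : Type*} [TopologicalSpace M] [ChartedSpace H M] [IsManifold I 1 M]
  {V : Type*} [NormedAddCommGroup V] [InnerProductSpace ℝ V]

theorem exists_fderiv_inChart_eq {f : M → V} {p : M} (hf : MDifferentiableAt I 𝓘(ℝ, V) f p)
    (v : TangentSpace I p) : ∃ w : E, (mfderiv I 𝓘(ℝ, V) f p v : V) =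
      fderiv ℝ (inChart I f p) (extChartAt I p p) w := by
  obtain ⟨w, hw⟩ : ∃ w : E,
      (mfderiv 𝓘(ℝ, E) I (extChartAt I p).symm (extChartAt I p p) w : E) = v :=
    (bijective_mfderiv_extChartAt_symm I (mem_extChartAt_target (I := I) p)).surjective v
  exact ⟨w, by rw [fderiv_inChart_self I hf, hw]⟩

theorem inner_fderiv_inChart_eq_zero {f : M → V} {p : M} (hf : MDifferentiableAt I 𝓘(ℝ, V) f p)
    (h1 : ∀ q, ‖f q‖ = 1) (w : E) :
    inner ℝ (f p) (fderiv ℝ (inChart I f p) (extChartAt I p p) w) = 0 := by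
  have hF : DifferentiableAt ℝ (inChart I f p) (extChartAt I p p) := by
    have h := (contMDiffAt_extChartAt_symm I (n := 1)
      (mem_extChartAt_target (I := I) p)).mdifferentiableAt one_ne_zero
    have hf' : MDifferentiableAt I 𝓘(ℝ, V) f ((extChartAt I p).symm (extChartAt I p p)) := by
      rwa [extChartAt_to_inv]
    exact (hf'.comp _ h).differentiableAt
  have := inner_fderiv_eq_zero_of_norm_eq_one hF (Filter.Eventually.of_forall fun u => h1 _) w
  rwa [inChart_extChartAt] at this

theorem inner_mfderiv_eq_zero {f : M → V} {p : M} (hf : MDifferentiableAt I 𝓘(ℝ, V) f p)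
    (h1 : ∀ q, ‖f q‖ = 1) (v : TangentSpace I p) :
    inner ℝ (f p) (mfderiv I 𝓘(ℝ, V) f p v : V) = 0 := by
  obtain ⟨w, hw⟩ := exists_fderiv_inChart_eq I hf v
  rw [hw, inner_fderiv_inChart_eq_zero I hf h1]

end UnitMaps

/-- The differential of a map into a normed space, as a linear map between the model spaces. -/
noncomputable def mfderivToSpace {E : Type*} [NormedAddCommGroup E] [NormedSpace ℝ E]
    {H : Type*} [TopologicalSpace H] (I : ModelWithCorners ℝ E H)
    {M : Type*} [TopologicalSpace M] [ChartedSpace H M]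
    {V : Type*} [NormedAddCommGroup V] [NormedSpace ℝ V] (f : M → V) (p : M) : E →L[ℝ] V :=
  mfderiv I 𝓘(ℝ, V) f p

/-- The target carries the model of the normed space `V × W` instead of a product of models, so maps
differentiated on that normed space can be composed with the pair. -/
theorem HasMFDerivAt.prodMk_space {E : Type*} [NormedAddCommGroup E] [NormedSpace ℝ E]
    {H : Type*} [TopologicalSpace H] {I : ModelWithCorners ℝ E H}
    {M : Type*} [TopologicalSpace M] [ChartedSpace H M]
    {V : Type*} [NormedAddCommGroup V] [NormedSpace ℝ V]
    {W : Type*} [NormedAddCommGroup W] [NormedSpace ℝ W] {f : M → V} {g : M → W} {p : M}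
    {f' : E →L[ℝ] V} {g' : E →L[ℝ] W} (hf : HasMFDerivAt I 𝓘(ℝ, V) f p f')
    (hg : HasMFDerivAt I 𝓘(ℝ, W) g p g') :
    HasMFDerivAt I 𝓘(ℝ, V × W) (fun q => (f q, g q)) p (f'.prod g') :=
  ⟨hf.1.prodMk hg.1, hf.2.prodMk hg.2⟩

theorem norm_spiralProduct {m₁ m₂ : ℕ} {L₁ L₂ : Type*} {γ₁ γ₂ : ℝ → ℂ}
    {f₁ : L₁ → EuclideanSpace ℂ (Fin m₁)} {f₂ : L₂ → EuclideanSpace ℂ (Fin m₂)} {p : ℝ × (L₁ × L₂)}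
    (hγ : ‖γ₁ p.1‖ ^ 2 + ‖γ₂ p.1‖ ^ 2 = 1)
    (h₁ : ‖f₁ p.2.1‖ = 1) (h₂ : ‖f₂ p.2.2‖ = 1) : ‖spiralProduct γ₁ γ₂ f₁ f₂ p‖ = 1 := by
  rw [← sq_eq_sq₀ (norm_nonneg _) zero_le_one, WithLp.prod_norm_sq_eq_of_L2]
  simp [spiralProduct, norm_smul, h₁, h₂, hγ]

/-! ### The spiral product on the manifold: metric, immersion, minimality -/

section SpiralProducts

variable {k₁ k₂ m₁ m₂ : ℕ}
  {L₁ : Type*} [TopologicalSpace L₁] [ChartedSpace (EuclideanSpace ℝ (Fin k₁)) L₁]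
  {L₂ : Type*} [TopologicalSpace L₂] [ChartedSpace (EuclideanSpace ℝ (Fin k₂)) L₂]
  {γ₁ γ₂ : ℝ → ℂ}
  {f₁ : L₁ → EuclideanSpace ℂ (Fin m₁)} {f₂ : L₂ → EuclideanSpace ℂ (Fin m₂)}

/-- Definitional: the product chart acts factorwise and is the identity on `ℝ`. -/
theorem inChart_spiralProduct (p : ℝ × (L₁ × L₂)) :
    inChart (𝓘(ℝ, ℝ).prod ((𝓡 k₁).prod (𝓡 k₂))) (spiralProduct γ₁ γ₂ f₁ f₂) p =
      spiralProduct γ₁ γ₂ (inChart (𝓡 k₁) f₁ p.2.1) (inChart (𝓡 k₂) f₂ p.2.2) :=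
  rfl

/-- The map factors through `(t, f₁ x, f₂ y)`, followed by the spiral product of the two identity
maps, to which the flat formula applies. -/
theorem hasMFDerivAt_spiralProduct {p : ℝ × (L₁ × L₂)}
    (hγ₁ : DifferentiableAt ℝ γ₁ p.1) (hγ₂ : DifferentiableAt ℝ γ₂ p.1)
    (hf₁ : MDifferentiableAt (𝓡 k₁) 𝓘(ℝ, EuclideanSpace ℂ (Fin m₁)) f₁ p.2.1)
    (hf₂ : MDifferentiableAt (𝓡 k₂) 𝓘(ℝ, EuclideanSpace ℂ (Fin m₂)) f₂ p.2.2) :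
    ∃ D : ℝ × (EuclideanSpace ℝ (Fin k₁) × EuclideanSpace ℝ (Fin k₂)) →L[ℝ]
        WithLp 2 (EuclideanSpace ℂ (Fin m₁) × EuclideanSpace ℂ (Fin m₂)),
      HasMFDerivAt (𝓘(ℝ, ℝ).prod ((𝓡 k₁).prod (𝓡 k₂)))
        𝓘(ℝ, WithLp 2 (EuclideanSpace ℂ (Fin m₁) × EuclideanSpace ℂ (Fin m₂)))
        (spiralProduct γ₁ γ₂ f₁ f₂) p D ∧
      ∀ v, D v = WithLp.toLp 2
        (v.1 • deriv γ₁ p.1 • f₁ p.2.1 + γ₁ p.1 •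
          mfderivToSpace (𝓡 k₁) f₁ p.2.1 v.2.1,
        v.1 • deriv γ₂ p.1 • f₂ p.2.2 + γ₂ p.1 •
          mfderivToSpace (𝓡 k₂) f₂ p.2.2 v.2.2) := by
  obtain ⟨D, hD, hDv⟩ := spiralProduct_hasFDerivAt (q := (p.1, f₁ p.2.1, f₂ p.2.2))
    (A := id) (B := id) hγ₁.hasDerivAt hγ₂.hasDerivAt (hasFDerivAt_id _) (hasFDerivAt_id _)
  have p1 : HasMFDerivAt (𝓘(ℝ, ℝ).prod ((𝓡 k₁).prod (𝓡 k₂))) 𝓘(ℝ, ℝ)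
    (fun p : ℝ × (L₁ × L₂) => p.1) p _ := hasMFDerivAt_fst p
  have p2 : HasMFDerivAt (𝓘(ℝ, ℝ).prod ((𝓡 k₁).prod (𝓡 k₂))) (𝓡 k₁)
    (fun p : ℝ × (L₁ × L₂) => p.2.1) p _ := (hasMFDerivAt_fst p.2).comp p (hasMFDerivAt_snd p)
  have p3 : HasMFDerivAt (𝓘(ℝ, ℝ).prod ((𝓡 k₁).prod (𝓡 k₂))) (𝓡 k₂)
    (fun p : ℝ × (L₁ × L₂) => p.2.2) p _ := (hasMFDerivAt_snd p.2).comp p (hasMFDerivAt_snd p)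
  have h := HasMFDerivAt.comp (g := spiralProduct γ₁ γ₂ id id)
    (f := fun p : ℝ × (L₁ × L₂) => (p.1, f₁ p.2.1, f₂ p.2.2)) p hD.hasMFDerivAt
    (HasMFDerivAt.prodMk_space p1 (HasMFDerivAt.prodMk_space
      (hf₁.hasMFDerivAt.comp p p2) (hf₂.hasMFDerivAt.comp p p3)))
  exact ⟨_, h, fun v => hDv _⟩

theorem mfderiv_spiralProduct {p : ℝ × (L₁ × L₂)}
    (hγ₁ : DifferentiableAt ℝ γ₁ p.1) (hγ₂ : DifferentiableAt ℝ γ₂ p.1)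
    (hf₁ : MDifferentiableAt (𝓡 k₁) 𝓘(ℝ, EuclideanSpace ℂ (Fin m₁)) f₁ p.2.1)
    (hf₂ : MDifferentiableAt (𝓡 k₂) 𝓘(ℝ, EuclideanSpace ℂ (Fin m₂)) f₂ p.2.2)
    (v : ℝ × (EuclideanSpace ℝ (Fin k₁) × EuclideanSpace ℝ (Fin k₂))) :
    (mfderiv (𝓘(ℝ, ℝ).prod ((𝓡 k₁).prod (𝓡 k₂)))
        𝓘(ℝ, WithLp 2 (EuclideanSpace ℂ (Fin m₁) × EuclideanSpace ℂ (Fin m₂)))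
        (spiralProduct γ₁ γ₂ f₁ f₂) p v :
        WithLp 2 (EuclideanSpace ℂ (Fin m₁) × EuclideanSpace ℂ (Fin m₂))) =
      WithLp.toLp 2
        (v.1 • deriv γ₁ p.1 • f₁ p.2.1 + γ₁ p.1 •
          mfderivToSpace (𝓡 k₁) f₁ p.2.1 v.2.1,
        v.1 • deriv γ₂ p.1 • f₂ p.2.2 + γ₂ p.1 •
          mfderivToSpace (𝓡 k₂) f₂ p.2.2 v.2.2) := by
  obtain ⟨D, hD, hDv⟩ := hasMFDerivAt_spiralProduct hγ₁ hγ₂ hf₁ hf₂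
  rw [hD.mfderiv]
  exact hDv v

theorem contMDiffAt_spiralProduct {n : ℕ∞ω} {p : ℝ × (L₁ × L₂)}
    (hγ₁ : ContDiffAt ℝ n γ₁ p.1) (hγ₂ : ContDiffAt ℝ n γ₂ p.1)
    (hf₁ : ContMDiffAt (𝓡 k₁) 𝓘(ℝ, EuclideanSpace ℂ (Fin m₁)) n f₁ p.2.1)
    (hf₂ : ContMDiffAt (𝓡 k₂) 𝓘(ℝ, EuclideanSpace ℂ (Fin m₂)) n f₂ p.2.2) :
    ContMDiffAt (𝓘(ℝ, ℝ).prod ((𝓡 k₁).prod (𝓡 k₂)))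
        𝓘(ℝ, WithLp 2 (EuclideanSpace ℂ (Fin m₁) × EuclideanSpace ℂ (Fin m₂))) n
      (spiralProduct γ₁ γ₂ f₁ f₂) p := by
  have hΦ := spiralProduct_contDiffAt (q := (p.1, f₁ p.2.1, f₂ p.2.2))
    (A := id) (B := id) hγ₁ hγ₂ contDiffAt_id contDiffAt_id
  have p1 : ContMDiffAt (𝓘(ℝ, ℝ).prod ((𝓡 k₁).prod (𝓡 k₂))) 𝓘(ℝ, ℝ) n
    (fun p : ℝ × (L₁ × L₂) => p.1) p := contMDiffAt_fst
  have p2 : ContMDiffAt (𝓘(ℝ, ℝ).prod ((𝓡 k₁).prod (𝓡 k₂))) (𝓡 k₁) n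
    (fun p : ℝ × (L₁ × L₂) => p.2.1) p :=
      (contMDiffAt_fst (p := p.2)).comp p contMDiffAt_snd
  have p3 : ContMDiffAt (𝓘(ℝ, ℝ).prod ((𝓡 k₁).prod (𝓡 k₂))) (𝓡 k₂) n
    (fun p : ℝ × (L₁ × L₂) => p.2.2) p :=
      (contMDiffAt_snd (p := p.2)).comp p contMDiffAt_snd
  exact ContMDiffAt.comp (g := spiralProduct γ₁ γ₂ id id)
    (f := fun p : ℝ × (L₁ × L₂) => (p.1, f₁ p.2.1, f₂ p.2.2)) p hΦ.contMDiffAt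
    (p1.prodMk_space ((hf₁.comp p p2).prodMk_space (hf₂.comp p p3)))

theorem inducedMetric_spiralProduct [IsManifold (𝓡 k₁) 1 L₁] [IsManifold (𝓡 k₂) 1 L₂]
    {p : ℝ × (L₁ × L₂)}
    (hγ₁ : DifferentiableAt ℝ γ₁ p.1) (hγ₂ : DifferentiableAt ℝ γ₂ p.1)
    (hf₁ : MDifferentiableAt (𝓡 k₁) 𝓘(ℝ, EuclideanSpace ℂ (Fin m₁)) f₁ p.2.1)
    (hf₂ : MDifferentiableAt (𝓡 k₂) 𝓘(ℝ, EuclideanSpace ℂ (Fin m₂)) f₂ p.2.2)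
    (h₁ : ∀ x, ‖f₁ x‖ = 1) (h₂ : ∀ y, ‖f₂ y‖ = 1)
    (hJ₁ : IsCTotallyReal (k := k₁) f₁) (hJ₂ : IsCTotallyReal (k := k₂) f₂) :
    inducedMetric (𝓘(ℝ, ℝ).prod ((𝓡 k₁).prod (𝓡 k₂))) (spiralProduct γ₁ γ₂ f₁ f₂) p =
      warpedMetric γ₁ γ₂ (inducedMetric (𝓡 k₁) f₁) (inducedMetric (𝓡 k₂) f₂) p := by
  funext v w
  have hv := mfderiv_spiralProduct hγ₁ hγ₂ hf₁ hf₂ v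
  have hw := mfderiv_spiralProduct hγ₁ hγ₂ hf₁ hf₂ w
  have z₁ := inner_mfderiv_eq_zero (𝓡 k₁) hf₁ h₁
  have z₂ := inner_mfderiv_eq_zero (𝓡 k₂) hf₂ h₂
  rw [inducedMetric]
  refine (congrArg₂ (inner ℝ : WithLp 2 (EuclideanSpace ℂ (Fin m₁) × EuclideanSpace ℂ (Fin m₂)) →
    WithLp 2 (EuclideanSpace ℂ (Fin m₁) × EuclideanSpace ℂ (Fin m₂)) → ℝ) hv hw).trans ?_
  rw [WithLp.prod_inner_apply]
  refine (congrArg₂ (· + ·)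
    (inner_velocity (h₁ p.2.1) (z₁ _) (hJ₁ _ _) (z₁ _) (hJ₁ _ _) _ _)
    (inner_velocity (h₂ p.2.2) (z₂ _) (hJ₂ _ _) (z₂ _) (hJ₂ _ _) _ _)).trans ?_
  simp only [warpedMetric, inducedMetric]
  ring

/-- The warped metric is positive definite: on a kernel vector its three nonnegative summands all
vanish, and their coefficients are positive. -/
theorem injective_mfderiv_spiralProduct [IsManifold (𝓡 k₁) 1 L₁] [IsManifold (𝓡 k₂) 1 L₂]
    {p : ℝ × (L₁ × L₂)}
    (hγ₁ : DifferentiableAt ℝ γ₁ p.1) (hγ₂ : DifferentiableAt ℝ γ₂ p.1)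
    (hf₁ : MDifferentiableAt (𝓡 k₁) 𝓘(ℝ, EuclideanSpace ℂ (Fin m₁)) f₁ p.2.1)
    (hf₂ : MDifferentiableAt (𝓡 k₂) 𝓘(ℝ, EuclideanSpace ℂ (Fin m₂)) f₂ p.2.2)
    (h₁ : ∀ x, ‖f₁ x‖ = 1) (h₂ : ∀ y, ‖f₂ y‖ = 1)
    (hJ₁ : IsCTotallyReal (k := k₁) f₁) (hJ₂ : IsCTotallyReal (k := k₂) f₂)
    (hγ₁0 : γ₁ p.1 ≠ 0) (hγ₂0 : γ₂ p.1 ≠ 0) (hρ : 0 < ‖deriv γ₁ p.1‖ ^ 2 + ‖deriv γ₂ p.1‖ ^ 2)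
    (hi₁ : Function.Injective (mfderiv (𝓡 k₁) 𝓘(ℝ, EuclideanSpace ℂ (Fin m₁)) f₁ p.2.1))
    (hi₂ : Function.Injective (mfderiv (𝓡 k₂) 𝓘(ℝ, EuclideanSpace ℂ (Fin m₂)) f₂ p.2.2)) :
    Function.Injective (mfderiv (𝓘(ℝ, ℝ).prod ((𝓡 k₁).prod (𝓡 k₂)))
        𝓘(ℝ, WithLp 2 (EuclideanSpace ℂ (Fin m₁) × EuclideanSpace ℂ (Fin m₂)))
      (spiralProduct γ₁ γ₂ f₁ f₂) p) := by
  rw [injective_iff_map_eq_zero]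
  intro v hv
  have h := congrFun (congrFun
    (inducedMetric_spiralProduct hγ₁ hγ₂ hf₁ hf₂ h₁ h₂ hJ₁ hJ₂) v) v
  have h0 : inducedMetric (𝓘(ℝ, ℝ).prod ((𝓡 k₁).prod (𝓡 k₂))) (spiralProduct γ₁ γ₂ f₁ f₂) p v v
      = 0 := by
    rw [inducedMetric, hv]
    exact inner_zero_left _
  rw [h0] at h
  change ℝ × (EuclideanSpace ℝ (Fin k₁) × EuclideanSpace ℝ (Fin k₂)) at v
  have e₁ : 0 ≤ inducedMetric (𝓡 k₁) f₁ p.2.1 v.2.1 v.2.1 := real_inner_self_nonneg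
  have e₂ : 0 ≤ inducedMetric (𝓡 k₂) f₂ p.2.2 v.2.2 v.2.2 := real_inner_self_nonneg
  have n₁ : 0 < ‖γ₁ p.1‖ ^ 2 := by positivity
  have n₂ : 0 < ‖γ₂ p.1‖ ^ 2 := by positivity
  have t₀ : 0 ≤ (‖deriv γ₁ p.1‖ ^ 2 + ‖deriv γ₂ p.1‖ ^ 2) * (v.1 * v.1) :=
    mul_nonneg hρ.le (mul_self_nonneg _)
  have t₁ := mul_nonneg n₁.le e₁
  have t₂ := mul_nonneg n₂.le e₂
  change 0 = (‖deriv γ₁ p.1‖ ^ 2 + ‖deriv γ₂ p.1‖ ^ 2) * (v.1 * v.1) +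
    ‖γ₁ p.1‖ ^ 2 * inducedMetric (𝓡 k₁) f₁ p.2.1 v.2.1 v.2.1 +
    ‖γ₂ p.1‖ ^ 2 * inducedMetric (𝓡 k₂) f₂ p.2.2 v.2.2 v.2.2 at h
  have v0 : v.1 = 0 := by
    have : (‖deriv γ₁ p.1‖ ^ 2 + ‖deriv γ₂ p.1‖ ^ 2) * (v.1 * v.1) = 0 := by linarith
    simpa [hρ.ne'] using this
  have v1 : inducedMetric (𝓡 k₁) f₁ p.2.1 v.2.1 v.2.1 = 0 :=
    (mul_eq_zero.1 (by linarith : ‖γ₁ p.1‖ ^ 2 * _ = 0)).resolve_left n₁.ne'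
  have v2 : inducedMetric (𝓡 k₂) f₂ p.2.2 v.2.2 v.2.2 = 0 :=
    (mul_eq_zero.1 (by linarith : ‖γ₂ p.1‖ ^ 2 * _ = 0)).resolve_left n₂.ne'
  have w1 : v.2.1 = 0 := hi₁ ((inner_self_eq_zero.1 v1).trans (map_zero _).symm)
  have w2 : v.2.2 = 0 := hi₂ ((inner_self_eq_zero.1 v2).trans (map_zero _).symm)
  exact Prod.ext v0 (Prod.ext w1 w2)

theorem meanCurvature_spiralProduct [IsManifold (𝓡 k₁) 2 L₁] [IsManifold (𝓡 k₂) 2 L₂]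
    {p : ℝ × (L₁ × L₂)}
    (hf₁ : IsMinimalImmersionOn (𝓡 k₁) (stdBasis k₁) f₁ Set.univ)
    (hf₂ : IsMinimalImmersionOn (𝓡 k₂) (stdBasis k₂) f₂ Set.univ)
    (hJ₁ : IsCTotallyReal (k := k₁) f₁) (hJ₂ : IsCTotallyReal (k := k₂) f₂)
    (hγ₁ : ContDiffAt ℝ 2 γ₁ p.1) (hγ₂ : ContDiffAt ℝ 2 γ₂ p.1)
    (hγ₁0 : γ₁ p.1 ≠ 0) (hγ₂0 : γ₂ p.1 ≠ 0) (hρ : 0 < ‖deriv γ₁ p.1‖ ^ 2 + ‖deriv γ₂ p.1‖ ^ 2)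
    {l μ : ℝ}
    (e₁ : (‖deriv γ₁ p.1‖ ^ 2 + ‖deriv γ₂ p.1‖ ^ 2)⁻¹ • deriv (deriv γ₁) p.1
      - (k₁ / ‖γ₁ p.1‖ ^ 2) • γ₁ p.1 = l • γ₁ p.1 + μ • deriv γ₁ p.1)
    (e₂ : (‖deriv γ₁ p.1‖ ^ 2 + ‖deriv γ₂ p.1‖ ^ 2)⁻¹ • deriv (deriv γ₂) p.1
      - (k₂ / ‖γ₂ p.1‖ ^ 2) • γ₂ p.1 = l • γ₂ p.1 + μ • deriv γ₂ p.1) :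
    meanCurvature (𝓘(ℝ, ℝ).prod ((𝓡 k₁).prod (𝓡 k₂))) (prodBasis k₁ k₂)
      (spiralProduct γ₁ γ₂ f₁ f₂) p = 0 := by
  have c₁ := hf₁.contMDiffOn.contMDiffAt (x := p.2.1) Filter.univ_mem
  have c₂ := hf₂.contMDiffOn.contMDiffAt (x := p.2.2) Filter.univ_mem
  have d₁ := c₁.mdifferentiableAt two_ne_zero
  have d₂ := c₂.mdifferentiableAt two_ne_zero
  have u₁ : ∀ x, ‖f₁ x‖ = 1 := fun x => by simpa using hf₁.mem_sphere x trivial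
  have u₂ : ∀ y, ‖f₂ y‖ = 1 := fun y => by simpa using hf₂.mem_sphere y trivial
  have hG := (contMDiffAt_spiralProduct hγ₁ hγ₂ c₁ c₂).mdifferentiableAt two_ne_zero
  obtain ⟨w₁, hw₁⟩ := hf₁.exists_trace_eq (𝓡 k₁) (stdBasis k₁) isOpen_univ (p := p.2.1) trivial
  obtain ⟨w₂, hw₂⟩ := hf₂.exists_trace_eq (𝓡 k₂) (stdBasis k₂) isOpen_univ (p := p.2.2) trivial
  set q := extChartAt (𝓘(ℝ, ℝ).prod ((𝓡 k₁).prod (𝓡 k₂))) p p with hq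
  have CA : ContDiffAt ℝ 2 (inChart (𝓡 k₁) f₁ p.2.1) q.2.1 := by
    change ContDiffAt ℝ 2 _ (extChartAt (𝓡 k₁) p.2.1 p.2.1)
    exact contDiffAt_inChart _ (mem_extChartAt_target _) (by rwa [extChartAt_to_inv])
  have CB : ContDiffAt ℝ 2 (inChart (𝓡 k₂) f₂ p.2.2) q.2.2 := by
    change ContDiffAt ℝ 2 _ (extChartAt (𝓡 k₂) p.2.2 p.2.2)
    exact contDiffAt_inChart _ (mem_extChartAt_target _) (by rwa [extChartAt_to_inv])
  have A0 : inChart (𝓡 k₁) f₁ p.2.1 q.2.1 = f₁ p.2.1 := inChart_extChartAt _ _ _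
  have B0 : inChart (𝓡 k₂) f₂ p.2.2 q.2.2 = f₂ p.2.2 := inChart_extChartAt _ _ _
  have htr := trace_fderiv_fderiv_spiralProduct (stdBasis k₁) (stdBasis k₂) (q := q)
    (c₁ := γ₁) (c₂ := γ₂) hγ₁ hγ₂ CA CB (by rw [A0, u₁]) (by rw [B0, u₂])
    (by rw [A0]; exact inner_fderiv_inChart_eq_zero _ d₁ u₁)
    (by rw [B0]; exact inner_fderiv_inChart_eq_zero _ d₂ u₂)
    (fun ξ => by rw [A0]; exact (congrArg _ (fderiv_inChart_self _ d₁ ξ)).trans (hJ₁ _ _))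
    (fun ξ => by rw [B0]; exact (congrArg _ (fderiv_inChart_self _ d₂ ξ)).trans (hJ₂ _ _))
    (linearIndependent_fderiv_inChart _ _ d₁ (hf₁.immersion _ trivial))
    (linearIndependent_fderiv_inChart _ _ d₂ (hf₂.immersion _ trivial)) hγ₁0 hγ₂0 hρ
  rw [meanCurvature_eq_starProjection _ _ hG, Submodule.starProjection_apply_eq_zero_iff,
    Submodule.orthogonal_orthogonal, radialTangentSpan_eq_inChart _ hG, inChart_spiralProduct]
  -- The witness: `l` and `μ` come from the curve, while the tangent parts `w₁, w₂` of the factor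
  -- traces are rescaled by `|γ_j|⁻²`, the factor by which warping scales the inverse metrics.
  have hsum : ∀ S,
      S = l • spiralProduct γ₁ γ₂ (inChart (𝓡 k₁) f₁ p.2.1) (inChart (𝓡 k₂) f₂ p.2.2) q +
      fderiv ℝ (spiralProduct γ₁ γ₂ (inChart (𝓡 k₁) f₁ p.2.1) (inChart (𝓡 k₂) f₂ p.2.2)) q
        (μ, (‖γ₁ p.1‖ ^ 2)⁻¹ • w₁, (‖γ₂ p.1‖ ^ 2)⁻¹ • w₂) →
      S ∈ Submodule.span ℝ
        ({spiralProduct γ₁ γ₂ (inChart (𝓡 k₁) f₁ p.2.1) (inChart (𝓡 k₂) f₂ p.2.2) q} ∪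
        Set.range fun v => fderiv ℝ (spiralProduct γ₁ γ₂ (inChart (𝓡 k₁) f₁ p.2.1)
          (inChart (𝓡 k₂) f₂ p.2.2)) q v) := by
    rintro S rfl
    exact add_mem (Submodule.smul_mem _ _ (Submodule.subset_span (Or.inl rfl)))
      (Submodule.subset_span (Or.inr ⟨_, rfl⟩))
  refine hsum _ (htr.trans ?_)
  -- One component of the identity: the `-k x` in the factor trace supplies the term `-k |c|⁻² c` of
  -- the curve equation.
  have key : ∀ {m : ℕ} {k : ℕ} {c c' c'' : ℂ} {ρ : ℝ} {x y z : EuclideanSpace ℂ (Fin m)},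
      ρ⁻¹ • c'' - (k / ‖c‖ ^ 2) • c = l • c + μ • c' →
      z = y - (k : ℝ) • x →
      ρ⁻¹ • c'' • x + (‖c‖ ^ 2)⁻¹ • c • z =
        l • c • x + (μ • c' • x + c • (‖c‖ ^ 2)⁻¹ • y) := by
    intro m k c c' c'' ρ x y z h hz
    have h' := congrArg (fun a : ℂ => a • x) h
    simp only [sub_smul, add_smul, smul_assoc] at h'
    rw [hz, smul_sub, smul_sub, smul_comm c (k : ℝ) x, smul_comm c (‖c‖ ^ 2)⁻¹ y, smul_smul,
      inv_mul_eq_div,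
      ← add_assoc, ← h']
    abel
  rw [fderiv_spiralProduct (q := q) (hγ₁.differentiableAt two_ne_zero)
    (hγ₂.differentiableAt two_ne_zero) (CA.differentiableAt two_ne_zero) (CB.differentiableAt two_ne_zero), map_smul, map_smul]
  rw [Fintype.card_fin] at hw₁ hw₂
  refine WithLp.ofLp_injective 2 (Prod.ext ?_ ?_)
  · exact (key e₁ (A0 ▸ hw₁))
  · exact (key e₂ (B0 ▸ hw₂))

end SpiralProducts

theorem mainTheorem1 (k₁ k₂ n₁ n₂ : ℕ)
    {L₁ : Type*} [TopologicalSpace L₁] [ChartedSpace (EuclideanSpace ℝ (Fin k₁)) L₁]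
    [IsManifold (𝓡 k₁) ∞ L₁]
    {L₂ : Type*} [TopologicalSpace L₂] [ChartedSpace (EuclideanSpace ℝ (Fin k₂)) L₂]
    [IsManifold (𝓡 k₂) ∞ L₂]
    (f₁ : L₁ → EuclideanSpace ℂ (Fin (n₁ + 1))) (f₂ : L₂ → EuclideanSpace ℂ (Fin (n₂ + 1)))
    (hf₁ : IsMinimalImmersionOn (𝓡 k₁) (stdBasis k₁) f₁ Set.univ)
    (hf₂ : IsMinimalImmersionOn (𝓡 k₂) (stdBasis k₂) f₂ Set.univ)
    (hJ₁ : IsCTotallyReal (k := k₁) f₁) (hJ₂ : IsCTotallyReal (k := k₂) f₂)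
    (T : Set ℝ) (γ₁ γ₂ : ℝ → ℂ) (hγ : IsSpiralCurve k₁ k₂ T γ₁ γ₂) :
    (∀ p ∈ T ×ˢ (Set.univ : Set (L₁ × L₂)),
      inducedMetric (𝓘(ℝ, ℝ).prod ((𝓡 k₁).prod (𝓡 k₂))) (spiralProduct γ₁ γ₂ f₁ f₂) p =
        warpedMetric γ₁ γ₂ (inducedMetric (𝓡 k₁) f₁) (inducedMetric (𝓡 k₂) f₂) p) ∧
    (∀ p ∈ T ×ˢ (Set.univ : Set (L₁ × L₂)),
      laplaceBeltrami (𝓘(ℝ, ℝ).prod ((𝓡 k₁).prod (𝓡 k₂))) (prodBasis k₁ k₂)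
          (inducedMetric (𝓘(ℝ, ℝ).prod ((𝓡 k₁).prod (𝓡 k₂))) (spiralProduct γ₁ γ₂ f₁ f₂))
          (spiralProduct γ₁ γ₂ f₁ f₂) p =
        -((k₁ : ℝ) + (k₂ : ℝ) + 1) • spiralProduct γ₁ γ₂ f₁ f₂ p) ∧
    IsMinimalImmersionOn (𝓘(ℝ, ℝ).prod ((𝓡 k₁).prod (𝓡 k₂))) (prodBasis k₁ k₂)
      (spiralProduct γ₁ γ₂ f₁ f₂) (T ×ˢ (Set.univ : Set (L₁ × L₂))) := by
  have hT : IsOpen T := hγ.1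
  have hU : IsOpen (T ×ˢ (Set.univ : Set (L₁ × L₂))) := hT.prod isOpen_univ
  obtain ⟨hγ₁, hγ₂, hcurve⟩ := hγ.exists_combination
  have g₁ : ∀ t ∈ T, ContDiffAt ℝ 2 γ₁ t := fun t ht => hγ₁.contDiffAt (hT.mem_nhds ht)
  have g₂ : ∀ t ∈ T, ContDiffAt ℝ 2 γ₂ t := fun t ht => hγ₂.contDiffAt (hT.mem_nhds ht)
  have c₁ := fun x => hf₁.contMDiffOn.contMDiffAt (x := x) Filter.univ_mem
  have c₂ := fun x => hf₂.contMDiffOn.contMDiffAt (x := x) Filter.univ_mem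
  have u₁ : ∀ x, ‖f₁ x‖ = 1 := fun x => by simpa using hf₁.mem_sphere x trivial
  have u₂ : ∀ y, ‖f₂ y‖ = 1 := fun y => by simpa using hf₂.mem_sphere y trivial
  have hmin : IsMinimalImmersionOn (𝓘(ℝ, ℝ).prod ((𝓡 k₁).prod (𝓡 k₂))) (prodBasis k₁ k₂)
      (spiralProduct γ₁ γ₂ f₁ f₂) (T ×ˢ (Set.univ : Set (L₁ × L₂))) := by
    constructor
    · exact fun p hp => (contMDiffAt_spiralProduct (g₁ _ hp.1) (g₂ _ hp.1) (c₁ _)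
        (c₂ _)).contMDiffWithinAt
    · intro p hp
      rw [mem_sphere_zero_iff_norm]
      exact norm_spiralProduct (hcurve p.1 hp.1).2.2.1 (u₁ _) (u₂ _)
    · intro p hp
      obtain ⟨h1, h2, -, hρ, -⟩ := hcurve p.1 hp.1
      exact injective_mfderiv_spiralProduct ((g₁ _ hp.1).differentiableAt two_ne_zero)
        ((g₂ _ hp.1).differentiableAt two_ne_zero) ((c₁ _).mdifferentiableAt two_ne_zero)
        ((c₂ _).mdifferentiableAt two_ne_zero) u₁ u₂ hJ₁ hJ₂ h1 h2 hρ
        (hf₁.immersion _ trivial) (hf₂.immersion _ trivial)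
    · intro p hp
      obtain ⟨h1, h2, -, hρ, l, μ, e₁, e₂⟩ := hcurve p.1 hp.1
      exact meanCurvature_spiralProduct hf₁ hf₂ hJ₁ hJ₂ (g₁ _ hp.1) (g₂ _ hp.1) h1 h2 hρ e₁ e₂
  refine ⟨fun p hp => ?_, fun p hp => ?_, hmin⟩
  · exact inducedMetric_spiralProduct ((g₁ _ hp.1).differentiableAt two_ne_zero)
      ((g₂ _ hp.1).differentiableAt two_ne_zero) ((c₁ _).mdifferentiableAt two_ne_zero)
      ((c₂ _).mdifferentiableAt two_ne_zero) u₁ u₂ hJ₁ hJ₂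
  · rw [hmin.laplaceBeltrami_eq _ _ hU hp]
    -- The dimension appears as the cardinality of `Unit ⊕ (Fin k₁ ⊕ Fin k₂)`.
    congr 2
    simp
    ring
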